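/- Let $G$ be a hyperbolic group with finite generating set $A$; that is, the geometric realization $\overline{\Gamma}_A(G)$ of the Cayley graph of $G$ with respect to $A$ (edges of length $1$) satisfies, for some $\delta\ge 0$, the Rips condition: in every geodesic triangle, every point of a side is at distance at most $\delta$ from the union of the other two sides. Let $d_A$ be the word metric on $G$ and write $(g|h)_p=\frac12\big(d_A(p,g)+d_A(p,h)-d_A(g,h)\big)$ for $g,h,p\in G$. Let $p\in G$, $\gamma>0$, $T\ge 1$, and let $d$ be a visual metric on $G$ with these parameters, i.e. a metric on $G$ such that $$\tfrac1T e^{-\gamma (g|h)_p}\le d(g,h)\le T e^{-\gamma (g|h)_p}\qquad\text{for all distinct } g,h\in G.$$ Let $\partial G$ be the set of equivalence classes of Gromov sequences, i.e. sequences $(g_n)$ in $G$ with $(g_i|g_j)_p\to+\infty$ as $i,j\to+\infty$, where $(g_n)$ and $(h_n)$ are equivalent if $(g_n|h_n)_p\to+\infty$. Let $\widehat G=G\cup\partial G$ with the metric $\widehat d$ extending $d$ for which $(\widehat G,\widehat d)$ is the completion of $(G,d)$ and each Gromov sequence converges to its class. Let $\varphi$ be a nontrivial endomorphism of $G$ (that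 is, $\varphi(G)\neq\{1\}$). Then the following conditions are equivalent: (i) $\varphi$ satisfies a Hölder condition with respect to $d$: there are $K>0$ and $r>0$ with $d(\varphi(g),\varphi(h))\le K\,d(g,h)^r$ for all $g,h\in G$; (ii) $\varphi$ admits an extension $\Phi:\widehat G\to\widehat G$ satisfying a Hölder condition with respect to $\widehat d$; (iii) there exist constants $P>0$ and $Q\in\mathbb{R}$ such that $P(\varphi(g)|\varphi(h))_p+Q\ge (g|h)_p$ for all $g,h\in G$; (iv) $\varphi$ is a quasi-isometric embedding of $(G,d_A)$ into itself: there are $\lambda\ge 1$ and $K\ge 0$ with $\frac1\lambda d_A(g,h)-K\le d_A(\varphi(g),\varphi(h))\le\lambda d_A(g,h)+K$ for all $g,h\in G$; (v) the kernel of $\varphi$ is finite and $\varphi(G)$ is a quasiconvex subgroup of $G$: for some $q\ge 0$, every point of every geodesic of $\overline{\Gamma}_A(G)$ with endpoints in $\varphi(G)$ is at distance at most $q$ from $\varphi(G)$. -/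

import Mathlib

open Filter Topology
open scoped NNReal

namespace HyperbolicGroup

/-! ### The geometric realization of a graph -/

section Realization

variable {V : Type*}

/-- The geometric realization of a graph, in barycentric coordinates: a point is a formal
convex combination `(1 - t) u + t v`, where `u` and `v` are equal or adjacent. So vertices are
points, every edge is a segment, and two edges meet only in common endpoints. -/
structure Realization (Γ : SimpleGraph V) where
  /-- The barycentric coordinates of the point. -/
  coord : V →₀ ℝ
  exists_edge : ∃ (u v : V) (t : ℝ), (u = v ∨ Γ.Adj u v) ∧ 0 ≤ t ∧ t ≤ 1 ∧
    coord = Finsupp.single u (1 - t) + Finsupp.single v t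

/-- A vertex, as a point of the geometric realization. -/
noncomputable def Realization.vertex (Γ : SimpleGraph V) (v : V) : Realization Γ :=
  ⟨Finsupp.single v 1, v, v, 0, Or.inl rfl, le_rfl, zero_le_one, by simp⟩

/-- Two points of the geometric realization lie on a common (closed) edge, or are the same
vertex. -/
def Realization.OnCommonEdge {Γ : SimpleGraph V} (x y : Realization Γ) : Prop :=
  ∃ u v : V, (u = v ∨ Γ.Adj u v) ∧
    (x.coord.support : Set V) ⊆ {u, v} ∧ (y.coord.support : Set V) ⊆ {u, v}

open Classical in
/-- The length metric of the geometric realization of a connected graph, where edges have length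
one. Points `(1 - t) u + t v` and `(1 - s) u + s v` of one edge have distance `|t - s|`, which is
half the `ℓ¹`-distance of the coordinates. Otherwise a shortest path from `x` to `y` leaves the
edge of `x` at an endpoint `u` (at distance `1 - x u` from `x`), proceeds to an endpoint `v` of
the edge of `y` along a shortest path of the graph, and from there to `y`. -/
noncomputable def Realization.rdist {Γ : SimpleGraph V} (x y : Realization Γ) : ℝ :=
  if x.OnCommonEdge y then ((x.coord - y.coord).sum fun _ c => |c|) / 2
  else ⨅ e : x.coord.support × y.coord.support,
    (1 - x.coord e.1) + (Γ.dist (e.1 : V) (e.2 : V) : ℝ) + (1 - y.coord e.2)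

end Realization

/-! ### Geodesics, hyperbolicity, quasi-isometric embeddings -/

section Metric

variable {X Y : Type*}

/-- `ξ` restricted to `[0, s]` is a geodesic from `x` to `y`, for the metric `d`. -/
def IsGeodesic (d : X → X → ℝ) (ξ : ℝ → X) (s : ℝ) (x y : X) : Prop :=
  0 ≤ s ∧ ξ 0 = x ∧ ξ s = y ∧
    ∀ a ∈ Set.Icc 0 s, ∀ b ∈ Set.Icc 0 s, d (ξ a) (ξ b) = |a - b|

/-- The distance of a point to a nonempty set, for the metric `d`. -/
noncomputable def distToSet (d : X → X → ℝ) (x : X) (S : Set X) : ℝ :=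
  ⨅ z : S, d x z

/-- The Rips condition: in every geodesic triangle, every point of a side has distance at most
`δ` from the union of the other two sides. -/
def IsDeltaHyperbolic (d : X → X → ℝ) (δ : ℝ) : Prop :=
  ∀ (x₀ x₁ x₂ : X) (ξ₀₁ ξ₁₂ ξ₀₂ : ℝ → X) (s₀₁ s₁₂ s₀₂ : ℝ),
    IsGeodesic d ξ₀₁ s₀₁ x₀ x₁ → IsGeodesic d ξ₁₂ s₁₂ x₁ x₂ → IsGeodesic d ξ₀₂ s₀₂ x₀ x₂ →
      ∀ y ∈ ξ₀₂ '' Set.Icc 0 s₀₂,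
        distToSet d y (ξ₀₁ '' Set.Icc 0 s₀₁ ∪ ξ₁₂ '' Set.Icc 0 s₁₂) ≤ δ

/-- Quasi-isometric embeddings with respect to the metrics `dX` and `dY`. -/
def IsQuasiIsometricEmbedding (dX : X → X → ℝ) (dY : Y → Y → ℝ) (f : X → Y) : Prop :=
  ∃ L K : ℝ, 1 ≤ L ∧ 0 ≤ K ∧
    ∀ x y, 1 / L * dX x y - K ≤ dY (f x) (f y) ∧ dY (f x) (f y) ≤ L * dX x y + K

/-- `f` satisfies a Hölder condition of some exponent `r > 0`. -/
def SatisfiesHolder [PseudoMetricSpace X] [PseudoMetricSpace Y] (f : X → Y) : Prop :=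
  ∃ C r : ℝ≥0, 0 < r ∧ HolderWith C r f

end Metric

/-! ### Word metrics, Gromov products, hyperbolic groups, quasiconvex subgroups -/

section Group

variable {G : Type*} [Group G]

/-- The word metric `d_A`: the length of a shortest path in the Cayley graph of `G` with respect
to the generating set `A`. -/
noncomputable def wordDist (A : Set G) (g h : G) : ℝ :=
  ((SimpleGraph.mulCayley A).dist g h : ℝ)

/-- The Gromov product `(g|h)_p` with respect to `d_A`. -/
noncomputable def gromovProduct (A : Set G) (p g h : G) : ℝ :=
  (wordDist A p g + wordDist A p h - wordDist A g h) / 2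

/-- The group `G`, with the finite generating set `A`, is hyperbolic: the geometric realization
of its Cayley graph is `δ`-hyperbolic for some `δ ≥ 0`. -/
def IsHyperbolicGroup (A : Set G) : Prop :=
  A.Finite ∧ Subgroup.closure A = ⊤ ∧
    ∃ δ : ℝ, 0 ≤ δ ∧
      IsDeltaHyperbolic (Realization.rdist (Γ := SimpleGraph.mulCayley A)) δ

/-- `H` is a quasiconvex subgroup of `G`: for some `q ≥ 0`, every point of a geodesic of the
geometric realization of the Cayley graph with endpoints in `H` has distance at most `q`
from `H`. -/
def IsQuasiconvex (A : Set G) (H : Subgroup G) : Prop :=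
  ∃ q : ℝ, 0 ≤ q ∧ ∀ h ∈ H, ∀ h' ∈ H,
    ∀ (ξ : ℝ → Realization (SimpleGraph.mulCayley A)) (s : ℝ),
      IsGeodesic Realization.rdist ξ s (Realization.vertex _ h) (Realization.vertex _ h') →
        ∀ x ∈ ξ '' Set.Icc 0 s,
          distToSet Realization.rdist x (Realization.vertex _ '' (H : Set G)) ≤ q

/-! ### The boundary -/

/-- Gromov sequences: `(g_i|g_j)_p → +∞` as `i, j → +∞`. -/
def IsGromovSeq (A : Set G) (p : G) (g : ℕ → G) : Prop :=
  Tendsto (fun k : ℕ × ℕ => gromovProduct A p (g k.1) (g k.2)) atTop atTop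

/-- Gromov sequences `g`, `h` are equivalent if `(g_n|h_n)_p → +∞`. -/
def GromovEquiv (A : Set G) (p : G) (g h : {g : ℕ → G // IsGromovSeq A p g}) : Prop :=
  Tendsto (fun n : ℕ => gromovProduct A p (g.1 n) (h.1 n)) atTop atTop

/-- The boundary `∂G`: Gromov sequences up to equivalence (in a hyperbolic group, `GromovEquiv`
is an equivalence relation). -/
def Boundary (A : Set G) (p : G) : Type _ := Quot (GromovEquiv A p)

/-- The set `Ĝ = G ∪ ∂G`. -/
inductive Hat (A : Set G) (p : G) : Type _
  | ofGroup (g : G) : Hat A p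
  | ofBoundary (α : Boundary A p) : Hat A p

/-! ### Visual metrics and the metric on `Ĝ` -/

/-- The metric of `G` belongs to `V^A(p, γ, T)`. -/
def IsVisual [MetricSpace G] (A : Set G) (p : G) (γ T : ℝ) : Prop :=
  ∀ g h : G, g ≠ h →
    1 / T * Real.exp (-γ * gromovProduct A p g h) ≤ dist g h ∧
      dist g h ≤ T * Real.exp (-γ * gromovProduct A p g h)

/-- The canonical map from `Ĝ` to the metric completion of `(G, d)`: it is the identity on `G`,
and sends the class of a Gromov sequence to the limit of that sequence. For a visual metric `d`
it does not depend on the representative, and it is a bijection: see `toCompletion_boundary` and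
`toCompletion_bijective`. -/
noncomputable def toCompletion [MetricSpace G] (A : Set G) (p : G) :
    Hat A p → UniformSpace.Completion G
  | .ofGroup g => (g : UniformSpace.Completion G)
  | .ofBoundary α =>
    haveI : Nonempty (UniformSpace.Completion G) := ⟨((1 : G) : UniformSpace.Completion G)⟩
    limUnder atTop fun n => ((Quot.out α).1 n : UniformSpace.Completion G)

/-- The metric `d̂` on `Ĝ`: the metric of the completion of `(G, d)`, where `Ĝ` is identified with
the completion by the canonical map. -/
noncomputable instance [MetricSpace G] (A : Set G) (p : G) : PseudoMetricSpace (Hat A p) :=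
  PseudoMetricSpace.induced (toCompletion A p) inferInstance

theorem mulCayley_connected {A : Set G} (hA : Subgroup.closure A = ⊤) :
    (SimpleGraph.mulCayley A).Connected := by
  have key : ∀ x ∈ Subgroup.closure A, ∀ g : G,
      (SimpleGraph.mulCayley A).Reachable g (g * x) := by
    intro x hx
    induction hx using Subgroup.closure_induction with
    | mem x hx =>
      intro g
      by_cases h : g = g * x
      · rw [← h]
      · exact SimpleGraph.Adj.reachable
          ((SimpleGraph.mulCayley_adj' _ _ _).2 ⟨h, x, hx, Or.inl rfl⟩)
    | one => intro g; simp
    | mul x y _ _ hx hy => intro g; rw [← mul_assoc]; exact (hx g).trans (hy (g * x))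
    | inv x _ hx => intro g; have := hx (g * x⁻¹); simp at this; exact this.symm
  have : Nonempty G := ⟨1⟩
  refine SimpleGraph.Connected.mk fun g h => ?_
  have := key (g⁻¹ * h) (by rw [hA]; trivial) g
  simpa using this

theorem gromovProduct_comm (A : Set G) (p g h : G) :
    gromovProduct A p g h = gromovProduct A p h g := by
  unfold gromovProduct wordDist
  rw [SimpleGraph.dist_comm (u := g) (v := h)]; ring

theorem gromovProduct_self (A : Set G) (p g : G) : gromovProduct A p g g = wordDist A p g := by
  simp [gromovProduct, wordDist]

theorem IsGromovSeq.tendsto_wordDist {A : Set G} {p : G} {g : ℕ → G} (hg : IsGromovSeq A p g) :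
    Tendsto (fun n => wordDist A p (g n)) atTop atTop := by
  have hdiag : Tendsto (fun n : ℕ => (n, n)) atTop atTop := tendsto_atTop_diagonal
  have h : Tendsto ((fun k : ℕ × ℕ => gromovProduct A p (g k.1) (g k.2)) ∘ fun n : ℕ => (n, n))
      atTop atTop := Tendsto.comp hg hdiag
  refine h.congr fun n => ?_
  simp only [Function.comp_apply, gromovProduct_self]

theorem gromovProduct_le {A : Set G} (hA : Subgroup.closure A = ⊤) (p g h : G) :
    gromovProduct A p g h ≤ wordDist A p g := by
  have := (mulCayley_connected hA).dist_triangle (u := p) (v := g) (w := h)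
  have : wordDist A p h ≤ wordDist A p g + wordDist A g h := by
    unfold wordDist; exact_mod_cast this
  unfold gromovProduct; linarith

section Completion

variable [MetricSpace G] {A : Set G} {p : G} {γ T : ℝ}

theorem IsVisual.tendsto_dist (hd : IsVisual A p γ T) (hγ : 0 < γ) (hT : 1 ≤ T)
    {ι : Type*} {l : Filter ι} {u v : ι → G}
    (h : Tendsto (fun i => gromovProduct A p (u i) (v i)) l atTop) :
    Tendsto (fun i => dist (u i) (v i)) l (𝓝 0) := by
  have h1 : Tendsto (fun i => T * Real.exp (-γ * gromovProduct A p (u i) (v i))) l (𝓝 (T * 0)) :=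
    (Real.tendsto_exp_atBot.comp (h.const_mul_atTop_of_neg (by linarith))).const_mul T
  rw [mul_zero] at h1
  refine squeeze_zero (fun _ => dist_nonneg) (fun i => ?_) h1
  by_cases e : u i = v i
  · rw [e, dist_self]; positivity
  · exact (hd _ _ e).2

theorem IsVisual.exp_le (hd : IsVisual A p γ T) (hT : 1 ≤ T) {g h : G} (e : g ≠ h) :
    Real.exp (-γ * gromovProduct A p g h) ≤ T * dist g h := by
  have := (hd g h e).1
  rwa [div_mul_eq_mul_div, one_mul, div_le_iff₀' (by linarith)] at this

theorem IsVisual.lt_gromovProduct (hd : IsVisual A p γ T) (hγ : 0 < γ) (hT : 1 ≤ T) {g h : G}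
    (e : g ≠ h) {M : ℝ} (hM : dist g h < Real.exp (-γ * M) / T) : M < gromovProduct A p g h := by
  rw [lt_div_iff₀' (by linarith)] at hM
  have := Real.exp_lt_exp.1 ((hd.exp_le hT e).trans_lt hM)
  nlinarith

theorem IsVisual.cauchySeq (hd : IsVisual A p γ T) (hγ : 0 < γ) (hT : 1 ≤ T) {g : ℕ → G}
    (hg : IsGromovSeq A p g) : CauchySeq g :=
  cauchySeq_iff_tendsto_dist_atTop_0.2 (hd.tendsto_dist hγ hT hg)

/-- The class of a Gromov sequence is sent to the limit of the sequence in the completion. -/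
theorem toCompletion_boundary (hd : IsVisual A p γ T) (hγ : 0 < γ) (hT : 1 ≤ T)
    (g : {g : ℕ → G // IsGromovSeq A p g}) :
    Tendsto (fun n => (g.1 n : UniformSpace.Completion G)) atTop
      (𝓝 (toCompletion A p (.ofBoundary (Quot.mk _ g)))) := by
  have conv : ∀ h : {g : ℕ → G // IsGromovSeq A p g}, ∃ x : UniformSpace.Completion G,
      Tendsto (fun n => (h.1 n : UniformSpace.Completion G)) atTop (𝓝 x) := fun h =>
    cauchySeq_tendsto_of_complete
      ((hd.cauchySeq hγ hT h.2).map (UniformSpace.Completion.uniformContinuous_coe G))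
  have h1 : Tendsto (fun n => ((Quot.out (Quot.mk (GromovEquiv A p) g)).1 n :
      UniformSpace.Completion G)) atTop (𝓝 (toCompletion A p (.ofBoundary (Quot.mk _ g)))) :=
    haveI : Nonempty (UniformSpace.Completion G) := ⟨((1 : G) : UniformSpace.Completion G)⟩
    tendsto_nhds_limUnder (conv (Quot.out (Quot.mk (GromovEquiv A p) g)))
  have h2 : ∀ a b, Relation.EqvGen (GromovEquiv A p) a b →
      Tendsto (fun n => dist (a.1 n) (b.1 n)) atTop (𝓝 0) := by
    intro a b hab
    induction hab with
    | rel a b h => exact hd.tendsto_dist hγ hT h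
    | refl a => simp
    | symm a b _ ih => simpa [dist_comm] using ih
    | trans a b c _ _ ih1 ih2 =>
      exact squeeze_zero (fun _ => dist_nonneg) (fun n => dist_triangle _ (b.1 n) _)
        (by simpa using ih1.add ih2)
  have h3 := h2 _ _ (Quot.eqvGen_exact (Quot.out_eq (Quot.mk (GromovEquiv A p) g)))
  refine (tendsto_iff_of_dist ?_).1 h1
  simp only [UniformSpace.Completion.dist_eq]
  exact h3

/-- For a visual metric, `Ĝ` is identified with the metric completion of `(G, d)`. -/
theorem toCompletion_bijective (hA : Subgroup.closure A = ⊤) (hd : IsVisual A p γ T)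
    (hγ : 0 < γ) (hT : 1 ≤ T) : Function.Bijective (toCompletion A p) := by
  have mixed : ∀ (g : G) (h : {g : ℕ → G // IsGromovSeq A p g}),
      toCompletion A p (.ofGroup g) ≠ toCompletion A p (.ofBoundary (Quot.mk _ h)) := by
    intro g h e
    have h1 := toCompletion_boundary hd hγ hT h
    rw [← e] at h1
    have h2 := tendsto_iff_dist_tendsto_zero.1 h1
    simp only [toCompletion, UniformSpace.Completion.dist_eq] at h2
    have h3 := h.2.tendsto_wordDist
    have h4 := h2.eventually_lt_const
      (u := Real.exp (-γ * wordDist A p g) / T)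
      (by have := Real.exp_pos (-γ * wordDist A p g); positivity)
    obtain ⟨n, hn1, hn2⟩ := (h4.and (h3.eventually_gt_atTop (wordDist A p g))).exists
    have hne : h.1 n ≠ g := by rintro e; rw [e] at hn2; exact lt_irrefl _ hn2
    have := hd.lt_gromovProduct hγ hT hne hn1
    rw [gromovProduct_comm] at this
    exact absurd (gromovProduct_le hA p g (h.1 n)) (not_le.2 this)
  constructor
  · rintro (g | α) (h | β) e
    · simpa [toCompletion] using e
    · obtain ⟨β, rfl⟩ := Quot.exists_rep β
      exact absurd e (mixed _ _)
    · obtain ⟨α, rfl⟩ := Quot.exists_rep α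
      exact absurd e.symm (mixed _ _)
    · obtain ⟨α, rfl⟩ := Quot.exists_rep α
      obtain ⟨β, rfl⟩ := Quot.exists_rep β
      have h1 := toCompletion_boundary hd hγ hT α
      have h2 := toCompletion_boundary hd hγ hT β
      rw [← e] at h2
      have h3 := h1.dist h2
      simp only [UniformSpace.Completion.dist_eq, dist_self] at h3
      have h4 := α.2.tendsto_wordDist
      refine congrArg Hat.ofBoundary (Quot.sound (tendsto_atTop.2 fun M => ?_))
      filter_upwards [h4.eventually_ge_atTop M, h3.eventually_lt_const
        (u := Real.exp (-γ * M) / T) (by have := Real.exp_pos (-γ * M); positivity)] with n hn1 hn2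
      by_cases e : α.1 n = β.1 n
      · rwa [← e, gromovProduct_self]
      · exact (hd.lt_gromovProduct hγ hT e hn2).le
  · intro x
    by_cases hx : ∃ g : G, (g : UniformSpace.Completion G) = x
    · obtain ⟨g, rfl⟩ := hx
      exact ⟨.ofGroup g, rfl⟩
    obtain ⟨y, hy, hyx⟩ := mem_closure_iff_seq_limit.1
      ((UniformSpace.Completion.denseRange_coe (α := G)).closure_eq ▸ Set.mem_univ x)
    choose g hg using hy
    obtain rfl : (fun n => (g n : UniformSpace.Completion G)) = y := funext hg
    have hc : CauchySeq g := by
      have := hyx.cauchySeq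
      rw [Metric.cauchySeq_iff] at this ⊢
      simpa only [UniformSpace.Completion.dist_eq] using this
    have hG : IsGromovSeq A p g := by
      refine tendsto_atTop.2 fun M => ?_
      obtain ⟨N, hN⟩ := Metric.cauchySeq_iff.1 hc (Real.exp (-γ * M) / T)
        (by have := Real.exp_pos (-γ * M); positivity)
      filter_upwards [eventually_ge_atTop (N, N)] with ⟨i, j⟩ hij
      by_cases e : g i = g j
      · simp only [← e, gromovProduct_self]
        by_contra hM
        refine hx ⟨g i, ?_⟩
        refine tendsto_nhds_unique (tendsto_const_nhds.congr' ?_) hyx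
        filter_upwards [eventually_ge_atTop N] with k hk
        by_contra hne
        have := hd.lt_gromovProduct hγ hT (fun e => hne (by rw [e])) (hN i hij.1 k hk)
        exact hM (this.le.trans (gromovProduct_le hA p _ _))
      · exact (hd.lt_gromovProduct hγ hT e (hN i hij.1 j hij.2)).le
    exact ⟨.ofBoundary (Quot.mk _ ⟨g, hG⟩),
      tendsto_nhds_unique (toCompletion_boundary hd hγ hT ⟨g, hG⟩) hyx⟩

end Completion

end Group

end HyperbolicGroup

open HyperbolicGroup

/-! Up to the factor `T`, a visual distance is the exponential of `-γ (g|h)_p`. Taking logarithms, a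
Hölder condition of exponent `r` becomes a linear inequality between Gromov products with `P = 1 /
r`, and conversely. The visual estimate says nothing when `φ g = φ h`; nontriviality of `φ` repairs
this by moving `g` to `g * s` with `φ s ≠ 1`. Hölder maps are uniformly continuous, so they extend
to the completion, which is `Ĝ`.

On the diagonal `(g|g)_p` is the distance from `p` to `g`, so the inequality for Gromov products
contains the lower bound of a quasi-isometric embedding; the upper bound holds for every
endomorphism. The converse uses hyperbolicity twice. The Gromov product of two points is, up to a
constant, the distance from `p` to a shortest path between them
(`HasThinTriangles.exists_dist_le_gromov`). Moreover, `φ` maps shortest paths to quasi-geodesics,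
and these stay close to shortest paths with the same endpoints
(`HasThinTriangles.exists_close_to_quasiGeodesic`). The same stability makes the image quasiconvex,
and the kernel lies in a ball.

If the image is quasiconvex and the kernel is finite, a shortest path from `1` to `φ x` can be
shadowed by image points `φ (y i)`. Consecutive `y i` differ by elements of a finite set, so the
length of `x` is linearly bounded by that of `φ x`.

The Rips condition enters only through `HasThinTriangles`, its version for vertices and shortest
paths. -/

namespace HyperbolicGroup

/-! ### The metric of the geometric realization -/

section RealizationMetric

variable {V : Type*} {Γ : SimpleGraph V}

/-- The affine extension of a function on the vertices to the geometric realization. -/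
noncomputable def Realization.lift (F : V → ℝ) (x : Realization Γ) : ℝ :=
  x.coord.sum fun v c => c * F v

theorem Realization.lift_eq (F : V → ℝ) {x : Realization Γ} {u v : V} {a b : ℝ}
    (h : x.coord = Finsupp.single u a + Finsupp.single v b) :
    x.lift F = a * F u + b * F v := by
  unfold Realization.lift
  rw [h, Finsupp.sum_add_index' (by simp) (by intros; ring), Finsupp.sum_single_index (by simp),
    Finsupp.sum_single_index (by simp)]

@[simp]
theorem Realization.lift_vertex (F : V → ℝ) (v : V) :
    (Realization.vertex Γ v).lift F = F v := by
  simp [Realization.lift, Realization.vertex]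

theorem Realization.coord_nonneg (x : Realization Γ) (w : V) : 0 ≤ x.coord w := by
  classical
  obtain ⟨u, v, t, -, h0, h1, hx⟩ := x.exists_edge
  rw [hx, Finsupp.add_apply]
  refine add_nonneg ?_ ?_ <;> rw [Finsupp.single_apply] <;> split_ifs <;> linarith

theorem Realization.sum_coord (x : Realization Γ) : (x.coord.sum fun _ c => c) = 1 := by
  obtain ⟨u, v, t, -, -, -, hx⟩ := x.exists_edge
  have := x.lift_eq (fun _ => 1) hx
  simp only [Realization.lift, mul_one] at this
  linarith

theorem Realization.support_nonempty (x : Realization Γ) : x.coord.support.Nonempty := by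
  by_contra h
  rw [Finset.not_nonempty_iff_eq_empty, Finsupp.support_eq_empty] at h
  have := x.sum_coord
  simp [h] at this

/-- A point of the realization in terms of a vertex of its edge. -/
theorem Realization.exists_edge_of_mem_support (x : Realization Γ) {w : V}
    (hw : w ∈ x.coord.support) :
    ∃ (w' : V) (t : ℝ), (w = w' ∨ Γ.Adj w w') ∧ 0 ≤ t ∧ t ≤ 1 ∧
      x.coord = Finsupp.single w (1 - t) + Finsupp.single w' t ∧ x.coord w = 1 - t := by
  obtain ⟨u, v, t, huv, h0, h1, hx⟩ := x.exists_edge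
  rcases huv with rfl | huv
  · have hx' : x.coord = Finsupp.single u 1 := by rw [hx, ← Finsupp.single_add]; simp
    have : w = u := by
      by_contra hne
      rw [Finsupp.mem_support_iff, hx', Finsupp.single_eq_of_ne hne] at hw
      exact hw rfl
    subst this
    exact ⟨w, 0, Or.inl rfl, le_rfl, zero_le_one, by simp [hx'], by simp [hx']⟩
  · have hne := huv.ne
    by_cases e1 : w = u
    · subst e1
      exact ⟨v, t, Or.inr huv, h0, h1, hx, by simp [hx, hne]⟩
    by_cases e2 : w = v
    · subst e2
      refine ⟨u, 1 - t, Or.inr huv.symm, by linarith, by linarith, ?_, by simp [hx, hne.symm]⟩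
      rw [hx, add_comm]; simp
    · exact absurd (by simp [hx, e1, e2]) (Finsupp.mem_support_iff.1 hw)

theorem Realization.eq_of_support_subset (x : Realization Γ) {u v : V}
    (h : (x.coord.support : Set V) ⊆ {u, v}) :
    ∃ t : ℝ, x.coord = Finsupp.single u (1 - t) + Finsupp.single v t := by
  classical
  obtain ⟨w, hw⟩ := x.support_nonempty
  obtain ⟨w', t, -, h0, h1, hx, -⟩ := x.exists_edge_of_mem_support hw
  have hw1 : w = u ∨ w = v := by simpa using h (by simpa using hw)
  -- For `t = 0` the second vertex `w'` may lie outside the support, so it need not be `u` or `v`.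
  by_cases ht : t = 0
  · subst ht
    rcases hw1 with rfl | rfl
    · exact ⟨0, by simp [hx]⟩
    · exact ⟨1, by simp [hx]⟩
  by_cases e : w = w'
  · subst e
    have hx' : x.coord = Finsupp.single w 1 := by rw [hx, ← Finsupp.single_add]; simp
    rcases hw1 with rfl | rfl
    · exact ⟨0, by simp [hx']⟩
    · exact ⟨1, by simp [hx']⟩
  have hw2 : w' = u ∨ w' = v := by
    have : w' ∈ x.coord.support := by
      rw [Finsupp.mem_support_iff, hx]
      simp [ht, Ne.symm e]
    simpa using h (by simpa using this)
  rcases hw1 with rfl | rfl <;> rcases hw2 with rfl | rfl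
  · exact absurd rfl e
  · exact ⟨t, hx⟩
  · exact ⟨1 - t, by rw [hx, add_comm]; simp⟩
  · exact absurd rfl e

/-- A function on the vertices that changes by at most one along edges. -/
def IsOneLipschitz (Γ : SimpleGraph V) (F : V → ℝ) : Prop :=
  ∀ u v, |F u - F v| ≤ Γ.dist u v

theorem isOneLipschitz_dist (hΓ : Γ.Connected) (o : V) :
    IsOneLipschitz Γ fun v => (Γ.dist o v : ℝ) := by
  intro u v
  have h1 : (Γ.dist o u : ℝ) ≤ Γ.dist o v + Γ.dist v u := by exact_mod_cast hΓ.dist_triangle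
  have h2 : (Γ.dist o v : ℝ) ≤ Γ.dist o u + Γ.dist u v := by exact_mod_cast hΓ.dist_triangle
  rw [Γ.dist_comm (u := v)] at h1
  rw [abs_le]; constructor <;> linarith

theorem IsOneLipschitz.le_one {F : V → ℝ} (hF : IsOneLipschitz Γ F) {u v : V}
    (h : u = v ∨ Γ.Adj u v) : |F u - F v| ≤ 1 := by
  rcases h with rfl | h
  · simp
  · have := hF u v
    rwa [SimpleGraph.dist_eq_one_iff_adj.2 h, Nat.cast_one] at this

theorem IsOneLipschitz.abs_lift_sub_le {F : V → ℝ} (hF : IsOneLipschitz Γ F) (x : Realization Γ)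
    {w : V} (hw : w ∈ x.coord.support) : |x.lift F - F w| ≤ 1 - x.coord w := by
  obtain ⟨w', t, hww, h0, h1, hx, hxw⟩ := x.exists_edge_of_mem_support hw
  have h := hF.le_one hww
  rw [x.lift_eq F hx, hxw, show (1 - t) * F w + t * F w' - F w = -(t * (F w - F w')) by ring,
    abs_neg, abs_mul, abs_of_nonneg h0]
  nlinarith

theorem sum_abs_add_le (f g : V →₀ ℝ) :
    ((f + g).sum fun _ c => |c|) ≤ (f.sum fun _ c => |c|) + g.sum fun _ c => |c| := by
  classical
  rw [Finsupp.sum_of_support_subset _ Finsupp.support_add _ (by simp),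
    Finsupp.sum_of_support_subset f (Finset.subset_union_left (s₂ := g.support)) _ (by simp),
    Finsupp.sum_of_support_subset g (Finset.subset_union_right (s₁ := f.support)) _ (by simp),
    ← Finset.sum_add_distrib]
  exact Finset.sum_le_sum fun i _ => abs_add_le _ _

theorem sum_abs_single_add_single_le (u v : V) (a b : ℝ) :
    ((Finsupp.single u a + Finsupp.single v b).sum fun _ c => |c|) ≤ |a| + |b| := by
  refine (sum_abs_add_le _ _).trans_eq ?_
  rw [Finsupp.sum_single_index (by simp), Finsupp.sum_single_index (by simp)]

theorem sum_abs_single_add_single {u v : V} (h : u ≠ v) (a b : ℝ) :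
    ((Finsupp.single u a + Finsupp.single v b).sum fun _ c => |c|) = |a| + |b| := by
  classical
  have hs : (Finsupp.single u a + Finsupp.single v b).support ⊆ {u, v} := by
    intro w hw
    by_contra hn
    simp only [Finset.mem_insert, Finset.mem_singleton, not_or] at hn
    simp [hn.1, hn.2] at hw
  rw [Finsupp.sum_of_support_subset _ hs _ (by simp), Finset.sum_pair h]
  simp [h, h.symm]

/-- All lower bounds on `rdist` come from here, by testing with the distance to a fixed vertex. This
replaces the triangle inequality of `rdist`, which is not needed. -/
theorem IsOneLipschitz.abs_lift_sub_lift_le {F : V → ℝ} (hF : IsOneLipschitz Γ F)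
    (x y : Realization Γ) : |x.lift F - y.lift F| ≤ x.rdist y := by
  unfold Realization.rdist
  split_ifs with h
  · obtain ⟨u, v, huv, hx, hy⟩ := h
    obtain ⟨t, ht⟩ := x.eq_of_support_subset hx
    obtain ⟨s, hs⟩ := y.eq_of_support_subset hy
    rw [x.lift_eq F ht, y.lift_eq F hs]
    by_cases e : u = v
    · subst e
      rw [show (1 - t) * F u + t * F u - ((1 - s) * F u + s * F u) = 0 by ring, abs_zero]
      exact div_nonneg (Finset.sum_nonneg fun _ _ => abs_nonneg _) zero_le_two
    · have hsub : x.coord - y.coord = Finsupp.single u (s - t) + Finsupp.single v (t - s) := by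
        simp only [ht, hs, Finsupp.single_sub]
        abel
      rw [hsub, sum_abs_single_add_single e, abs_sub_comm t s, add_self_div_two,
        show (1 - t) * F u + t * F v - ((1 - s) * F u + s * F v) = (s - t) * (F u - F v) by ring,
        abs_mul]
      exact mul_le_of_le_one_right (abs_nonneg _) (hF.le_one huv)
  · have := x.support_nonempty.to_subtype
    have := y.support_nonempty.to_subtype
    refine le_ciInf fun ⟨⟨u, hu⟩, ⟨w, hw⟩⟩ => ?_
    have h1 := hF.abs_lift_sub_le x hu
    have h2 := hF.abs_lift_sub_le y hw
    have h3 := hF u w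
    rw [abs_le] at *
    constructor <;> linarith

theorem Realization.rdist_nonneg (x y : Realization Γ) : 0 ≤ x.rdist y :=
  (abs_nonneg _).trans (IsOneLipschitz.abs_lift_sub_lift_le (F := fun _ => 0) (by intro; simp) x y)

/-- Without a common edge, the right side is one of the terms of the infimum. On a common edge, the
triangle inequality for half the `ℓ¹`-distance through the vertices `u` and `w` suffices, as
distinct vertices have half `ℓ¹`-distance `1`, which is at most their graph distance. -/
theorem Realization.rdist_le (hΓ : Γ.Connected) (x y : Realization Γ) {u w : V}
    (hu : u ∈ x.coord.support) (hw : w ∈ y.coord.support) :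
    x.rdist y ≤ (1 - x.coord u) + Γ.dist u w + (1 - y.coord w) := by
  unfold Realization.rdist
  split_ifs with h
  · have key : ∀ (z : Realization Γ) {v : V}, v ∈ z.coord.support →
        ((z.coord - Finsupp.single v 1).sum fun _ c => |c|) ≤ 2 * (1 - z.coord v) := by
      intro z v hv
      obtain ⟨v', t, -, h0, h1, hz, hzv⟩ := z.exists_edge_of_mem_support hv
      have e : z.coord - Finsupp.single v 1 = Finsupp.single v (-t) + Finsupp.single v' t := by
        rw [hz, Finsupp.single_sub, Finsupp.single_neg]; abel
      rw [e, hzv]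
      refine (sum_abs_single_add_single_le _ _ _ _).trans ?_
      rw [abs_neg, abs_of_nonneg h0]; linarith
    have neg : ∀ f : V →₀ ℝ, ((-f).sum fun _ c => |c|) = f.sum fun _ c => |c| := by
      intro f; rw [Finsupp.sum_neg_index (by simp)]; simp
    have mid : ((Finsupp.single u (1 : ℝ) - Finsupp.single w 1).sum fun _ c => |c|)
        ≤ 2 * (Γ.dist u w : ℝ) := by
      by_cases e : u = w
      · subst e; simp
      · have h1 : (1 : ℝ) ≤ Γ.dist u w := by exact_mod_cast hΓ.pos_dist_of_ne e
        have := sum_abs_single_add_single_le u w 1 (-1)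
        rw [Finsupp.single_neg, ← sub_eq_add_neg] at this
        norm_num at this
        linarith
    have hy := key y hw
    rw [← neg, neg_sub] at hy
    have e : x.coord - y.coord = ((x.coord - Finsupp.single u 1) +
        (Finsupp.single u 1 - Finsupp.single w 1)) + (Finsupp.single w 1 - y.coord) := by abel
    rw [e]
    linarith [sum_abs_add_le ((x.coord - Finsupp.single u 1) +
        (Finsupp.single u 1 - Finsupp.single w 1)) (Finsupp.single w 1 - y.coord),
      sum_abs_add_le (x.coord - Finsupp.single u 1) (Finsupp.single u 1 - Finsupp.single w 1),
      key x hu]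
  · exact ciInf_le (Set.finite_range _).bddBelow
      ((⟨u, hu⟩, ⟨w, hw⟩) : x.coord.support × y.coord.support)

theorem Realization.rdist_le_of_eq {x y : Realization Γ} {u v : V} (huv : u = v ∨ Γ.Adj u v)
    {t s : ℝ} (hx : x.coord = Finsupp.single u (1 - t) + Finsupp.single v t)
    (hy : y.coord = Finsupp.single u (1 - s) + Finsupp.single v s) : x.rdist y ≤ |t - s| := by
  have supp : ∀ {z : Realization Γ} {r : ℝ},
      z.coord = Finsupp.single u (1 - r) + Finsupp.single v r →
      (z.coord.support : Set V) ⊆ {u, v} := by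
    intro z r hz w hw
    by_contra hn
    simp only [Set.mem_insert_iff, Set.mem_singleton_iff, not_or] at hn
    simp [hz, hn.1, hn.2] at hw
  unfold Realization.rdist
  rw [if_pos ⟨u, v, huv, supp hx, supp hy⟩]
  have hsub : x.coord - y.coord = Finsupp.single u (s - t) + Finsupp.single v (t - s) := by
    simp only [hx, hy, Finsupp.single_sub]
    abel
  rw [hsub]
  have := sum_abs_single_add_single_le u v (s - t) (t - s)
  rw [abs_sub_comm s t] at this
  linarith

theorem Realization.mem_support_vertex (v : V) : v ∈ (Realization.vertex Γ v).coord.support := by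
  simp [Realization.vertex]

theorem Realization.rdist_vertex_le (hΓ : Γ.Connected) (x : Realization Γ) {u : V} (w : V)
    (hu : u ∈ x.coord.support) :
    x.rdist (Realization.vertex Γ w) ≤ (1 - x.coord u) + Γ.dist u w := by
  have := Realization.rdist_le hΓ x (Realization.vertex Γ w) hu (Realization.mem_support_vertex w)
  simpa [Realization.vertex] using this

theorem Realization.dist_le_rdist_add_one (hΓ : Γ.Connected) (w : V) (x : Realization Γ) {u : V}
    (hu : u ∈ x.coord.support) :
    (Γ.dist w u : ℝ) ≤ (Realization.vertex Γ w).rdist x + (1 - x.coord u) := by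
  have hF := isOneLipschitz_dist hΓ w
  have h1 := abs_le.1 (hF.abs_lift_sub_lift_le (Realization.vertex Γ w) x)
  have h2 := abs_le.1 (hF.abs_lift_sub_le x hu)
  simp only [Realization.lift_vertex, SimpleGraph.dist_self, Nat.cast_zero] at h1
  linarith

/-! ### Geodesics through the vertices of a shortest path -/

/-- The vertices of a shortest path of length `n`. -/
def IsDiscreteGeodesic (Γ : SimpleGraph V) (f : ℕ → V) (n : ℕ) : Prop :=
  ∀ i j, i ≤ j → j ≤ n → Γ.dist (f i) (f j) = j - i

theorem exists_isDiscreteGeodesic (hΓ : Γ.Connected) (x y : V) :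
    ∃ f : ℕ → V, f 0 = x ∧ f (Γ.dist x y) = y ∧ IsDiscreteGeodesic Γ f (Γ.dist x y) := by
  obtain ⟨p, hp⟩ := hΓ.exists_walk_length_eq_dist x y
  have step : ∀ i k, Γ.dist (p.getVert i) (p.getVert (i + k)) ≤ k := by
    intro i k
    induction k with
    | zero => simp
    | succ k ih =>
      refine (hΓ.dist_triangle (v := p.getVert (i + k))).trans (Nat.add_le_add ih ?_)
      by_cases h : i + k < p.length
      · exact (SimpleGraph.dist_eq_one_iff_adj.2 (p.adj_getVert_succ h)).le
      · rw [p.getVert_of_length_le (not_lt.1 h), p.getVert_of_length_le (i := i + (k + 1)) (by omega)]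
        simp
  refine ⟨p.getVert, by simp, by rw [← hp]; simp, fun i j hij hj => ?_⟩
  -- The three pieces of the walk have lengths at most `i`, `j - i` and `p.length - j`. These add up
  -- to the distance of the endpoints, so no piece can be shorter.
  have h1 := step 0 i
  have h2 := step i (j - i)
  have h3 := step j (p.length - j)
  rw [show i + (j - i) = j by omega] at h2
  rw [show j + (p.length - j) = p.length by omega] at h3
  simp only [zero_add, p.getVert_zero, p.getVert_length] at h1 h3
  have h4 := hΓ.dist_triangle (u := x) (v := p.getVert i) (w := y)
  have h5 := hΓ.dist_triangle (u := p.getVert i) (v := p.getVert j) (w := y)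
  omega

theorem IsDiscreteGeodesic.adj {f : ℕ → V} {n : ℕ} (hf : IsDiscreteGeodesic Γ f n) {i : ℕ}
    (h : i < n) : Γ.Adj (f i) (f (i + 1)) := by
  rw [← SimpleGraph.dist_eq_one_iff_adj, hf i (i + 1) (by omega) h]
  omega

/-- A shortest path is traversed by a geodesic of the geometric realization. -/
theorem IsDiscreteGeodesic.exists_isGeodesic (hΓ : Γ.Connected) {f : ℕ → V} {n : ℕ}
    (hf : IsDiscreteGeodesic Γ f n) :
    ∃ ξ : ℝ → Realization Γ,
      IsGeodesic Realization.rdist ξ n (Realization.vertex Γ (f 0)) (Realization.vertex Γ (f n)) ∧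
      (∀ i ≤ n, ξ i = Realization.vertex Γ (f i)) ∧
      ∀ a ∈ Set.Icc (0 : ℝ) n, ∃ i ≤ n, f i ∈ (ξ a).coord.support := by
  have ceil_cases : ∀ a : ℝ, 0 ≤ a → ((⌈a⌉₊ = ⌊a⌋₊ ∧ a = ⌊a⌋₊) ∨
      (⌈a⌉₊ = ⌊a⌋₊ + 1 ∧ (⌊a⌋₊ : ℝ) < a)) := by
    intro a ha
    rcases (Nat.floor_le ha).lt_or_eq with h | h
    · refine Or.inr ⟨le_antisymm (Nat.ceil_le_floor_add_one a) ?_, h⟩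
      exact Nat.lt_ceil.2 h
    · refine Or.inl ⟨?_, h.symm⟩
      rw [← h]; simp
  have hceil : ∀ a : ℝ, a ≤ n → ⌈a⌉₊ ≤ n := fun a h => Nat.ceil_le.2 h
  -- The point at time `a` divides the edge from `f ⌊a⌋₊` to `f ⌈a⌉₊` in the ratio given by the
  -- fractional part; at integers the edge degenerates to a vertex. Values outside `[0, n]` are
  -- arbitrary.
  have hpt : ∀ a : ℝ, ∃ x : Realization Γ, 0 ≤ a → a ≤ n →
      x.coord = Finsupp.single (f ⌊a⌋₊) (1 - (a - ⌊a⌋₊)) +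
        Finsupp.single (f ⌈a⌉₊) (a - ⌊a⌋₊) := by
    intro a
    by_cases h : 0 ≤ a ∧ a ≤ n
    · refine ⟨⟨_, f ⌊a⌋₊, f ⌈a⌉₊, a - ⌊a⌋₊, ?_, by linarith [Nat.floor_le h.1],
        by linarith [Nat.lt_floor_add_one a], rfl⟩, fun _ _ => rfl⟩
      rcases ceil_cases a h.1 with hc | hc
      · rw [hc.1]; exact Or.inl rfl
      · have := hceil a h.2
        rw [hc.1] at this ⊢
        exact Or.inr (hf.adj this)
    · exact ⟨Realization.vertex Γ (f 0), fun h1 h2 => absurd ⟨h1, h2⟩ h⟩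
  choose ξ hξ using hpt
  have hint : ∀ i ≤ n, ξ i = Realization.vertex Γ (f i) := by
    intro i hi
    have := hξ i (Nat.cast_nonneg i) (by exact_mod_cast hi)
    rcases h : ξ i with ⟨c, hc⟩
    rw [h] at this
    simp only [Nat.floor_natCast, Nat.ceil_natCast, sub_self, sub_zero, Finsupp.single_zero,
      add_zero] at this
    simp only [Realization.vertex, this]
  have hfloor : ∀ a : ℝ, 0 ≤ a → a ≤ n → f ⌊a⌋₊ ∈ (ξ a).coord.support ∧
      1 - (ξ a).coord (f ⌊a⌋₊) ≤ a - ⌊a⌋₊ := by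
    intro a h0 h1
    have h2 : (ξ a).coord (f ⌊a⌋₊) ≥ 1 - (a - ⌊a⌋₊) := by
      rw [hξ a h0 h1, Finsupp.add_apply, Finsupp.single_eq_same, ge_iff_le, le_add_iff_nonneg_right]
      exact (Finsupp.single_nonneg.2 (by linarith [Nat.floor_le h0])) _
    refine ⟨Finsupp.mem_support_iff.2 fun h => ?_, by linarith⟩
    linarith [Nat.lt_floor_add_one a]
  have hceil' : ∀ a : ℝ, 0 ≤ a → a ≤ n → f ⌈a⌉₊ ∈ (ξ a).coord.support ∧
      1 - (ξ a).coord (f ⌈a⌉₊) ≤ ⌈a⌉₊ - a := by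
    intro a h0 h1
    rcases ceil_cases a h0 with hc | hc
    · have := hfloor a h0 h1
      rw [hc.1]
      refine ⟨this.1, this.2.trans ?_⟩
      linarith [hc.2]
    · have h2 : (ξ a).coord (f ⌈a⌉₊) ≥ a - ⌊a⌋₊ := by
        rw [hξ a h0 h1, Finsupp.add_apply, Finsupp.single_eq_same, ge_iff_le,
          le_add_iff_nonneg_left]
        exact (Finsupp.single_nonneg.2 (by linarith [Nat.lt_floor_add_one a])) _
      refine ⟨Finsupp.mem_support_iff.2 fun h => ?_, ?_⟩
      · linarith [hc.2]
      · rw [hc.1] at h2 ⊢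
        push_cast
        linarith
  have upper : ∀ a b : ℝ, 0 ≤ a → a ≤ b → b ≤ n →
      (ξ a).rdist (ξ b) ≤ b - a ∧ (ξ b).rdist (ξ a) ≤ b - a := by
    intro a b ha hab hb
    -- Either an integer lies between `a` and `b`, and the path through the vertices gives the
    -- bound, or both points lie on the same edge.
    by_cases h : ⌈a⌉₊ ≤ ⌊b⌋₊
    · have h1 := hceil' a ha (hab.trans hb)
      have h2 := hfloor b (ha.trans hab) hb
      have h3 : Γ.dist (f ⌈a⌉₊) (f ⌊b⌋₊) = (⌊b⌋₊ : ℝ) - ⌈a⌉₊ := by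
        rw [hf _ _ h ((Nat.floor_le_ceil b).trans (hceil b hb)), Nat.cast_sub h]
      have h4 := Realization.rdist_le hΓ _ _ h1.1 h2.1
      have h5 := Realization.rdist_le hΓ _ _ h2.1 h1.1
      rw [Γ.dist_comm] at h5
      constructor <;> linarith [h1.2, h2.2]
    · have h1 := Nat.floor_le_floor hab
      have h2 := Nat.ceil_le_ceil hab
      have e1 : ⌊a⌋₊ = ⌊b⌋₊ := by rcases ceil_cases a ha with hc | hc <;> omega
      have e2 : ⌈a⌉₊ = ⌈b⌉₊ := by
        rcases ceil_cases a ha with hc | hc <;>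
          rcases ceil_cases b (ha.trans hab) with hc' | hc' <;> omega
      have hx := hξ a ha (hab.trans hb)
      have hy := hξ b (ha.trans hab) hb
      rw [← e1, ← e2] at hy
      have huv : f ⌊a⌋₊ = f ⌈a⌉₊ ∨ Γ.Adj (f ⌊a⌋₊) (f ⌈a⌉₊) := by
        rcases ceil_cases a ha with hc | hc
        · rw [hc.1]; exact Or.inl rfl
        · have := hceil a (hab.trans hb)
          rw [hc.1] at this ⊢
          exact Or.inr (hf.adj this)
      have h3 := Realization.rdist_le_of_eq huv hx hy
      have h4 := Realization.rdist_le_of_eq huv hy hx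
      rw [abs_of_nonpos (by linarith)] at h3
      rw [abs_of_nonneg (by linarith)] at h4
      constructor <;> linarith
  -- The distance to `f 0`, extended affinely, recovers the parameter; being 1-Lipschitz, it yields
  -- the lower bound on distances along `ξ`.
  have lift_eq : ∀ a : ℝ, 0 ≤ a → a ≤ n → (ξ a).lift (fun v => (Γ.dist (f 0) v : ℝ)) = a := by
    intro a h0 h1
    rw [Realization.lift_eq _ (hξ a h0 h1),
      hf 0 _ (Nat.zero_le _) ((Nat.floor_le_ceil a).trans (hceil a h1)),
      hf 0 _ (Nat.zero_le _) (hceil a h1)]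
    rcases ceil_cases a h0 with hc | hc
    · rw [hc.1, Nat.sub_zero]
      linarith [hc.2]
    · rw [hc.1]; simp only [Nat.sub_zero]; push_cast; ring
  refine ⟨ξ, ⟨Nat.cast_nonneg n, ?_, hint n le_rfl, ?_⟩, hint, ?_⟩
  · exact_mod_cast hint 0 (Nat.zero_le n)
  · intro a ha b hb
    have lower := (isOneLipschitz_dist hΓ (f 0)).abs_lift_sub_lift_le (ξ a) (ξ b)
    rw [lift_eq a ha.1 ha.2, lift_eq b hb.1 hb.2] at lower
    refine le_antisymm ?_ lower
    rcases le_total a b with hab | hab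
    · rw [abs_of_nonpos (by linarith)]; linarith [upper a b ha.1 hab hb.2]
    · rw [abs_of_nonneg (by linarith)]; linarith [upper b a hb.1 hab ha.2]
  · intro a ha
    exact ⟨⌊a⌋₊, (Nat.floor_le_ceil a).trans (hceil a ha.2), (hfloor a ha.1 ha.2).1⟩

/-! ### Thin triangles in terms of vertices -/

/-- Geodesic triangles with vertices in the graph are `D`-thin. Here `w` lies on some shortest path
from `x` to `z` if and only if `d(x, w) + d(w, z) = d(x, z)`. -/
def HasThinTriangles (Γ : SimpleGraph V) (D : ℕ) : Prop :=
  ∀ x y z w : V, Γ.dist x w + Γ.dist w z = Γ.dist x z →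
    ∃ u : V, Γ.dist w u ≤ D ∧
      (Γ.dist x u + Γ.dist u y = Γ.dist x y ∨ Γ.dist y u + Γ.dist u z = Γ.dist y z)

/-- Shortest paths from `x` to `w` and from `w` to `z` are concatenated; any shortcut between the
two pieces would contradict `h`. -/
theorem exists_isDiscreteGeodesic_through (hΓ : Γ.Connected) {x w z : V}
    (h : Γ.dist x w + Γ.dist w z = Γ.dist x z) :
    ∃ f : ℕ → V, f 0 = x ∧ f (Γ.dist x w) = w ∧ f (Γ.dist x z) = z ∧
      IsDiscreteGeodesic Γ f (Γ.dist x z) := by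
  obtain ⟨f, f0, f1, hf⟩ := exists_isDiscreteGeodesic hΓ x w
  obtain ⟨g, g0, g1, hg⟩ := exists_isDiscreteGeodesic hΓ w z
  have key : ∀ i j, i ≤ Γ.dist x w → Γ.dist x w ≤ j → j ≤ Γ.dist x z →
      Γ.dist (f i) (g (j - Γ.dist x w)) = j - i := by
    intro i j hi hj hj'
    have h1 := hf 0 i (Nat.zero_le i) hi
    have h2 := hf i _ hi le_rfl
    have h3 := hg 0 (j - Γ.dist x w) (Nat.zero_le _) (by omega)
    have h4 := hg (j - Γ.dist x w) _ (by omega) le_rfl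
    rw [f0] at h1
    rw [f1] at h2
    rw [g0] at h3
    rw [g1] at h4
    have h5 := hΓ.dist_triangle (u := f i) (v := w) (w := g (j - Γ.dist x w))
    have h6 := hΓ.dist_triangle (u := x) (v := f i) (w := g (j - Γ.dist x w))
    have h7 := hΓ.dist_triangle (u := x) (v := g (j - Γ.dist x w)) (w := z)
    omega
  refine ⟨fun i => if i ≤ Γ.dist x w then f i else g (i - Γ.dist x w), by simp [f0], by simp [f1],
    ?_, fun i j hij hj => ?_⟩
  · dsimp only
    split_ifs with h1
    · have : Γ.dist w z = 0 := by omega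
      rw [show Γ.dist x z = Γ.dist x w by omega, f1]
      exact hΓ.dist_eq_zero_iff.1 this
    · rw [show Γ.dist x z - Γ.dist x w = Γ.dist w z by omega, g1]
  · dsimp only
    split_ifs with h1 h2 h2
    · exact hf i j hij h2
    · exact key i j h1 (by omega) hj
    · omega
    · rw [hg _ _ (by omega) (by omega)]; omega

theorem IsDiscreteGeodesic.dist_add_dist {f : ℕ → V} {n : ℕ} (hf : IsDiscreteGeodesic Γ f n)
    {i : ℕ} (hi : i ≤ n) : Γ.dist (f 0) (f i) + Γ.dist (f i) (f n) = Γ.dist (f 0) (f n) := by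
  rw [hf 0 i (Nat.zero_le i) hi, hf i n hi le_rfl, hf 0 n (Nat.zero_le n) le_rfl]
  omega

/-- The Rips condition is applied to realized shortest paths, the one from `x` to `z` chosen through
`w`. The nearby point `q` on another side is then replaced by a vertex of that side. -/
theorem IsDeltaHyperbolic.hasThinTriangles (hΓ : Γ.Connected) {δ : ℝ}
    (h : IsDeltaHyperbolic (Realization.rdist (Γ := Γ)) δ) : ∃ D, HasThinTriangles Γ D := by
  -- One unit is lost because the infimum in `distToSet` is only approximated, the other in passing
  -- from `q` to a vertex of its edge.
  refine ⟨⌈δ + 2⌉₊, fun x y z w hw => ?_⟩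
  obtain ⟨f, f0, fw, f1, hf⟩ := exists_isDiscreteGeodesic_through hΓ hw
  obtain ⟨g, g0, g1, hg⟩ := exists_isDiscreteGeodesic hΓ x y
  obtain ⟨k, k0, k1, hk⟩ := exists_isDiscreteGeodesic hΓ y z
  obtain ⟨ξf, hξf, hfi, -⟩ := hf.exists_isGeodesic hΓ
  obtain ⟨ξg, hξg, -, hgs⟩ := hg.exists_isGeodesic hΓ
  obtain ⟨ξk, hξk, -, hks⟩ := hk.exists_isGeodesic hΓ
  rw [f0, f1] at hξf
  rw [g0, g1] at hξg
  rw [k0, k1] at hξk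
  have hwz : Γ.dist x w ≤ Γ.dist x z := by omega
  have h1 := h _ _ _ _ _ _ _ _ _ hξg hξk hξf (ξf (Γ.dist x w : ℝ))
    ⟨_, ⟨Nat.cast_nonneg _, by exact_mod_cast hwz⟩, rfl⟩
  rw [hfi _ hwz, fw] at h1
  unfold distToSet at h1
  have hne : Nonempty ↑(ξg '' Set.Icc 0 (Γ.dist x y : ℝ) ∪ ξk '' Set.Icc 0 (Γ.dist y z : ℝ)) :=
    ⟨⟨ξg 0, Or.inl ⟨0, ⟨le_rfl, Nat.cast_nonneg _⟩, rfl⟩⟩⟩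
  obtain ⟨⟨q, hq⟩, hq'⟩ := exists_lt_of_ciInf_lt (h1.trans_lt (lt_add_one δ))
  have close : ∀ u ∈ q.coord.support, Γ.dist w u ≤ ⌈δ + 2⌉₊ := by
    intro u hu
    have h2 := Realization.dist_le_rdist_add_one hΓ w q hu
    have h3 := q.coord_nonneg u
    have h4 := Nat.le_ceil (δ + 2)
    dsimp only at hq'
    have : (Γ.dist w u : ℝ) ≤ ⌈δ + 2⌉₊ := by linarith
    exact_mod_cast this
  rcases hq with ⟨a, ha, rfl⟩ | ⟨a, ha, rfl⟩
  · obtain ⟨i, hi, hu⟩ := hgs a ha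
    refine ⟨g i, close _ hu, Or.inl ?_⟩
    have := hg.dist_add_dist hi
    rwa [g0, g1] at this
  · obtain ⟨i, hi, hu⟩ := hks a ha
    refine ⟨k i, close _ hu, Or.inr ?_⟩
    have := hk.dist_add_dist hi
    rwa [k0, k1] at this

end RealizationMetric

/-! ### Stability of quasi-geodesics and Gromov products -/

section Stability

variable {V : Type*} {Γ : SimpleGraph V}

/-- In a graph with thin triangles, a shortest path comes exponentially close to any chain with the
same endpoints. -/
theorem HasThinTriangles.exists_dist_le_mul {D : ℕ} (h : HasThinTriangles Γ D) (k : ℕ) :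
    ∀ (N : ℕ) (c : ℕ → V) (w : V), 1 ≤ N → N ≤ 2 ^ k →
      Γ.dist (c 0) w + Γ.dist w (c N) = Γ.dist (c 0) (c N) → Γ.Connected →
      ∃ i < N, ∃ u, Γ.dist w u ≤ k * D ∧
        Γ.dist (c i) u + Γ.dist u (c (i + 1)) = Γ.dist (c i) (c (i + 1)) := by
  induction k with
  | zero =>
    intro N c w h1 h2 hw _
    obtain rfl : N = 1 := by simp at h2; omega
    exact ⟨0, by omega, w, by simp, hw⟩
  | succ k ih =>
    intro N c w h1 h2 hw hΓ
    by_cases hN : N ≤ 2 ^ k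
    · obtain ⟨i, hi, u, hu, hu'⟩ := ih N c w h1 hN hw hΓ
      exact ⟨i, hi, u, hu.trans (Nat.mul_le_mul_right _ (Nat.le_succ k)), hu'⟩
    · have hpos : 1 ≤ 2 ^ k := Nat.one_le_two_pow
      rw [pow_succ] at h2
      -- The chain is cut at `c (2 ^ k)`. At the cost of `D`, the point `w` moves to a shortest path
      -- spanned by one of the two halves, each with at most `2 ^ k` links.
      obtain ⟨v, hv, hv' | hv'⟩ := h (c 0) (c (2 ^ k)) (c N) w hw
      · obtain ⟨i, hi, u, hu, hu'⟩ := ih (2 ^ k) c v hpos le_rfl hv' hΓ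
        refine ⟨i, by omega, u, ?_, hu'⟩
        have := hΓ.dist_triangle (u := w) (v := v) (w := u)
        rw [add_mul, one_mul]; omega
      · obtain ⟨i, hi, u, hu, hu'⟩ := ih (N - 2 ^ k) (fun t => c (2 ^ k + t)) v (by omega)
          (by omega) (by
            rwa [add_zero, show 2 ^ k + (N - 2 ^ k) = N by omega]) hΓ
        refine ⟨2 ^ k + i, by omega, u, ?_, hu'⟩
        have := hΓ.dist_triangle (u := w) (v := v) (w := u)
        rw [add_mul, one_mul]; omega

theorem exists_forall_add_mul_le_two_pow (A B : ℕ) : ∃ k₀, ∀ k ≥ k₀, A + k * B ≤ 2 ^ k := by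
  -- With `s = A + B` and `k = s + j`, the power is at least `(s + 1) * (j + 1)`. This exceeds `A +
  -- (s + j) * B` as soon as `s * s ≤ j`.
  refine ⟨(A + B) + (A + B) * (A + B), fun k hk => ?_⟩
  obtain ⟨j, rfl⟩ : ∃ j, k = (A + B) + j := ⟨k - (A + B), by omega⟩
  have hj : (A + B) * (A + B) ≤ j := by omega
  have h1 : A + B + 1 ≤ 2 ^ (A + B) := Nat.lt_two_pow_self
  have h2 : j + 1 ≤ 2 ^ j := Nat.lt_two_pow_self
  rw [pow_add]
  refine le_trans ?_ (Nat.mul_le_mul h1 h2)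
  nlinarith [Nat.zero_le (A * j), Nat.zero_le (A * (A + B))]

/-- A number bounded by the logarithm of a linear function of itself is bounded. -/
theorem exists_bound_of_le_log (a b L D : ℕ) :
    ∃ R, ∀ M, (∀ k, a * M + b ≤ 2 ^ k → M ≤ L + k * D) → M ≤ R := by
  -- If the least admissible exponent were `k + 1 > k₀`, then `M ≤ L + (k + 1) * D` would give `a *
  -- M + b ≤ (a * (L + D) + b) + k * (a * D) ≤ 2 ^ k`, so that `k` is admissible too.
  obtain ⟨k₀, hk₀⟩ := exists_forall_add_mul_le_two_pow (a * (L + D) + b) (a * D)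
  refine ⟨L + k₀ * D, fun M hM => ?_⟩
  have hex : ∃ k, a * M + b ≤ 2 ^ k := ⟨_, Nat.lt_two_pow_self.le⟩
  classical
  have h1 := Nat.find_spec hex
  by_cases h : Nat.find hex ≤ k₀
  · exact (hM _ h1).trans (Nat.add_le_add_left (Nat.mul_le_mul_right _ h) _)
  · obtain ⟨k, hk⟩ : ∃ k, Nat.find hex = k + 1 := ⟨Nat.find hex - 1, by omega⟩
    refine absurd ?_ (Nat.find_min hex (m := k) (by omega))
    have h2 := hM _ h1
    rw [hk] at h2
    have h3 := hk₀ k (by omega)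
    have h4 := Nat.mul_le_mul_left a h2
    nlinarith

/-- The indices of a chain can be traversed in both directions. -/
theorem exists_chain_between {c : ℕ → V} {n L a b : ℕ}
    (hc : ∀ i < n, Γ.dist (c i) (c (i + 1)) ≤ L)
    (hq : ∀ i j, i ≤ j → j ≤ n → j - i ≤ a * Γ.dist (c i) (c j) + b) {i j : ℕ} (hi : i ≤ n)
    (hj : j ≤ n) :
    ∃ (m : ℕ) (e : ℕ → V), e 0 = c i ∧ e m = c j ∧ m ≤ a * Γ.dist (c i) (c j) + b ∧
      (∀ t < m, Γ.dist (e t) (e (t + 1)) ≤ L) ∧ ∀ t ≤ m, ∃ l ≤ n, e t = c l := by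
  rcases le_total i j with h | h
  · refine ⟨j - i, fun t => c (i + t), by simp, ?_, hq i j h hj, fun t ht => ?_,
      fun t ht => ⟨i + t, by omega, rfl⟩⟩
    · dsimp only; rw [show i + (j - i) = j by omega]
    · exact hc _ (by omega)
  · refine ⟨i - j, fun t => c (i - t), by simp, ?_, ?_, fun t ht => ?_,
      fun t ht => ⟨i - t, by omega, rfl⟩⟩
    · dsimp only; rw [show i - (i - j) = j by omega]
    · rw [Γ.dist_comm]; exact hq j i h hi
    · dsimp only
      rw [Γ.dist_comm, show i - t = i - (t + 1) + 1 by omega]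
      exact hc _ (by omega)

/-- Stability of quasi-geodesics: shortest paths stay close to quasi-geodesics with the same
endpoints. -/
theorem HasThinTriangles.exists_close_to_quasiGeodesic (hΓ : Γ.Connected) {D : ℕ}
    (h : HasThinTriangles Γ D) (L a b : ℕ) :
    ∃ R, ∀ (n : ℕ) (c : ℕ → V), (∀ i < n, Γ.dist (c i) (c (i + 1)) ≤ L) →
      (∀ i j, i ≤ j → j ≤ n → j - i ≤ a * Γ.dist (c i) (c j) + b) →
      ∀ w, Γ.dist (c 0) w + Γ.dist w (c n) = Γ.dist (c 0) (c n) →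
        ∃ i ≤ n, Γ.dist w (c i) ≤ R := by
  -- Let `M` be the largest distance from a point of a shortest path to the chain, attained at `w`.
  -- A detour from one side of `w` to the other along the chain has at most `6 * a * M + b + 2`
  -- links, yet `w` is logarithmically close to one of them. This forces `M ≤ L + k * D` whenever `2
  -- ^ k` bounds the number of links.
  obtain ⟨R, hR⟩ := exists_bound_of_le_log (6 * a) (b + 2) L D
  refine ⟨R, fun n c hc hq => ?_⟩
  have hex : ∃ M, ∀ w, Γ.dist (c 0) w + Γ.dist w (c n) = Γ.dist (c 0) (c n) →
      ∃ i ≤ n, Γ.dist w (c i) ≤ M := by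
    refine ⟨Γ.dist (c 0) (c n), fun w hw => ⟨0, Nat.zero_le n, ?_⟩⟩
    rw [Γ.dist_comm]; omega
  classical
  obtain ⟨M, hM, hmin⟩ : ∃ M, (∀ w, Γ.dist (c 0) w + Γ.dist w (c n) = Γ.dist (c 0) (c n) →
      ∃ i ≤ n, Γ.dist w (c i) ≤ M) ∧ ∀ M' < M, ∃ w,
        Γ.dist (c 0) w + Γ.dist w (c n) = Γ.dist (c 0) (c n) ∧ ∀ i ≤ n, M' < Γ.dist w (c i) := by
    refine ⟨Nat.find hex, Nat.find_spec hex, fun M' hM' => ?_⟩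
    have := Nat.find_min hex hM'
    push Not at this
    exact this
  suffices M ≤ R by
    intro w hw
    obtain ⟨i, hi, hi'⟩ := hM w hw
    exact ⟨i, hi, hi'.trans this⟩
  refine hR M fun k hk => ?_
  rcases Nat.eq_zero_or_pos M with rfl | hpos
  · exact Nat.zero_le _
  obtain ⟨w, hw, hfar⟩ := hmin (M - 1) (by omega)
  obtain ⟨f, f0, fw, f1, hf⟩ := exists_isDiscreteGeodesic_through hΓ hw
  -- points on both sides of `w`, close to the quasi-geodesic
  have hy : ∃ y, ∃ i ≤ n, y ≤ Γ.dist (c 0) w ∧ Γ.dist (c 0) w ≤ y + 2 * M ∧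
      Γ.dist (f y) (c i) ≤ M ∧ (f y = c i ∨ Γ.dist (c 0) w = y + 2 * M) := by
    by_cases hs : Γ.dist (c 0) w ≤ 2 * M
    · exact ⟨0, 0, Nat.zero_le n, Nat.zero_le _, by omega, by simp [f0], Or.inl f0⟩
    · have := hf.dist_add_dist (i := Γ.dist (c 0) w - 2 * M) (by omega)
      rw [f0, f1] at this
      obtain ⟨i, hi, hi'⟩ := hM _ this
      exact ⟨_, i, hi, by omega, by omega, hi', Or.inr (by omega)⟩
  have hz : ∃ z, ∃ i ≤ n, Γ.dist (c 0) w ≤ z ∧ z ≤ Γ.dist (c 0) (c n) ∧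
      z ≤ Γ.dist (c 0) w + 2 * M ∧
      Γ.dist (f z) (c i) ≤ M ∧ (f z = c i ∨ z = Γ.dist (c 0) w + 2 * M) := by
    by_cases hs : Γ.dist (c 0) (c n) ≤ Γ.dist (c 0) w + 2 * M
    · exact ⟨_, n, le_rfl, by omega, le_rfl, hs, by simp [f1], Or.inl f1⟩
    · have := hf.dist_add_dist (i := Γ.dist (c 0) w + 2 * M) (by omega)
      rw [f0, f1] at this
      obtain ⟨i, hi, hi'⟩ := hM _ this
      exact ⟨_, i, hi, by omega, by omega, le_rfl, hi', Or.inr rfl⟩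
  obtain ⟨y, i, hi, hyw, hyM, hyi, hy'⟩ := hy
  obtain ⟨z, j, hj, hwz, hzn, hzM, hzj, hz'⟩ := hz
  obtain ⟨m, e, e0, e1, hm, he, hec⟩ := exists_chain_between hc hq hi hj
  have dyw := hf y _ hyw (by omega)
  have dwz := hf _ z hwz hzn
  have dyz := hf y z (by omega) hzn
  rw [fw] at dyw dwz
  -- At most `M` from `c i` to `f y`, `4 * M` from `f y` to `f z`, and `M` from `f z` to `c j`.
  have hij : Γ.dist (c i) (c j) ≤ 6 * M := by
    have h1 := hΓ.dist_triangle (u := c i) (v := f y) (w := c j)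
    have h2 := hΓ.dist_triangle (u := f y) (v := f z) (w := c j)
    rw [Γ.dist_comm] at hyi
    omega
  have hm' : m + 2 ≤ 2 ^ k := by nlinarith [Nat.mul_le_mul_left a hij]
  -- a point of the segment from `q` to `c l` is at distance at least `M` from `w`
  have side : ∀ {q u : V} {l : ℕ}, l ≤ n → Γ.dist q (c l) ≤ M →
      (q = c l ∨ Γ.dist w q = 2 * M) → Γ.dist q u + Γ.dist u (c l) = Γ.dist q (c l) →
      M ≤ Γ.dist w u := by
    intro q u l hl h1 h2 h3
    rcases h2 with rfl | h2
    · rw [SimpleGraph.dist_self] at h3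
      have : c l = u := hΓ.dist_eq_zero_iff.1 (by omega)
      have := hfar l hl
      subst u
      omega
    · have := hΓ.dist_triangle (u := w) (v := u) (w := q)
      rw [Γ.dist_comm (u := u) (v := q)] at this
      omega
  -- The detour is `f y, e 0, ..., e m, f z`. A point `u` on the first or last link is at least `M`
  -- away from `w` by `side`; on any other link it is within `L` of a chain point, which is itself
  -- at least `M` away from `w`.
  obtain ⟨t, ht, u, hu, hu'⟩ := h.exists_dist_le_mul k (m + 2)
    (fun t => if t = 0 then f y else if t ≤ m + 1 then e (t - 1) else f z) w (by omega) hm'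
    (by
      simp only [if_true, show m + 2 ≠ 0 by omega, if_false, show ¬ m + 2 ≤ m + 1 by omega]
      rw [dyw, dwz, dyz]; omega) hΓ
  rcases Nat.eq_zero_or_pos t with rfl | htpos
  · simp only [if_true, zero_add, one_ne_zero, if_false, show 1 ≤ m + 1 by omega, Nat.sub_self,
      e0] at hu'
    have := side hi hyi (hy'.imp id fun h' => by rw [Γ.dist_comm, dyw]; omega) hu'
    omega
  by_cases htm : t = m + 1
  · subst htm
    simp only [show m + 1 ≠ 0 by omega, if_false, le_refl, if_true, Nat.add_sub_cancel, e1,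
      show m + 1 + 1 ≠ 0 by omega, show ¬ m + 1 + 1 ≤ m + 1 by omega] at hu'
    have := side (u := u) hj hzj (hz'.imp id fun h' => by rw [dwz]; omega) (by
      rw [Γ.dist_comm (u := f z) (v := u), Γ.dist_comm (u := u) (v := c j),
        Γ.dist_comm (u := f z) (v := c j)]; omega)
    omega
  · simp only [show t ≠ 0 by omega, if_false, show t ≤ m + 1 by omega, if_true,
      show t + 1 ≠ 0 by omega, show t + 1 ≤ m + 1 by omega] at hu'
    have h1 := he (t - 1) (by omega)
    obtain ⟨l, hl, hl'⟩ := hec (t - 1) (by omega)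
    rw [show t - 1 + 1 = t + 1 - 1 by omega] at h1
    have h2 := hfar l hl
    have h3 := hΓ.dist_triangle (u := w) (v := u) (w := c l)
    rw [← hl', Γ.dist_comm (u := u)] at h3
    rw [← hl'] at h2
    omega

/-- Some point of a shortest path from `x` to `y` has distance to `o` at most the Gromov product
of `x` and `y` based at `o`, up to a constant. -/
theorem HasThinTriangles.exists_dist_le_gromov (hΓ : Γ.Connected) {D : ℕ}
    (h : HasThinTriangles Γ D) (o x y : V) :
    ∃ w, Γ.dist x w + Γ.dist w y = Γ.dist x y ∧
      2 * Γ.dist o w + Γ.dist x y ≤ Γ.dist o x + Γ.dist o y + (4 * D + 2) := by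
  obtain ⟨f, f0, f1, hf⟩ := exists_isDiscreteGeodesic hΓ x y
  -- Each point of the path is close to a shortest path from `x` to `o` or to one from `o` to `y`.
  -- Just before the first point that is not close to the former kind, a point is close to both
  -- kinds, with `D + 1` in place of `D` for the latter. The two detours then cost `2 * D + 2 * (D +
  -- 1) = 4 * D + 2`.
  have key : ∃ i ≤ Γ.dist x y,
      (∃ u, Γ.dist (f i) u ≤ D ∧ Γ.dist x u + Γ.dist u o = Γ.dist x o) ∧
      ∃ v, Γ.dist (f i) v ≤ D + 1 ∧ Γ.dist o v + Γ.dist v y = Γ.dist o y := by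
    by_cases hall : ∀ i ≤ Γ.dist x y,
        ∃ u, Γ.dist (f i) u ≤ D ∧ Γ.dist x u + Γ.dist u o = Γ.dist x o
    · exact ⟨_, le_rfl, hall _ le_rfl, y, by simp [f1], by simp⟩
    · push Not at hall
      classical
      have h1 := Nat.find_spec hall
      obtain ⟨i, hi⟩ : ∃ i, Nat.find hall = i + 1 := by
        refine Nat.exists_eq_succ_of_ne_zero fun h0 => ?_
        rw [h0, f0] at h1
        exact h1.2 x (by simp) (by simp)
      have h2 := Nat.find_min hall (m := i) (by omega)
      rw [hi] at h1
      push Not at h2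
      have h3 := hf.dist_add_dist h1.1
      rw [f0, f1] at h3
      obtain ⟨v, hv, hv' | hv'⟩ := h x o y _ h3
      · exact absurd hv' (h1.2 v hv)
      · refine ⟨i, by omega, h2 (by omega), v, ?_, hv'⟩
        have h4 := hΓ.dist_triangle (u := f i) (v := f (i + 1)) (w := v)
        rw [hf i (i + 1) (by omega) h1.1] at h4
        omega
  obtain ⟨i, hi, ⟨u, hu, hu'⟩, v, hv, hv'⟩ := key
  have h1 := hf.dist_add_dist hi
  rw [f0, f1] at h1
  refine ⟨f i, h1, ?_⟩
  have h2 := hΓ.dist_triangle (u := x) (v := u) (w := f i)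
  have h3 := hΓ.dist_triangle (u := o) (v := u) (w := f i)
  have h4 := hΓ.dist_triangle (u := o) (v := v) (w := f i)
  have h5 := hΓ.dist_triangle (u := f i) (v := v) (w := y)
  have s1 := Γ.dist_comm (u := u) (v := f i)
  have s2 := Γ.dist_comm (u := v) (v := f i)
  have s3 := Γ.dist_comm (u := o) (v := x)
  have s4 := Γ.dist_comm (u := o) (v := u)
  omega

end Stability

/-! ### Word metrics and endomorphisms -/

section WordMetric

variable {G : Type*} [Group G] {A : Set G}

theorem dist_mul_left_le (hA : Subgroup.closure A = ⊤) (k g h : G) :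
    (SimpleGraph.mulCayley A).dist (k * g) (k * h) ≤ (SimpleGraph.mulCayley A).dist g h := by
  obtain ⟨w, hw⟩ := (mulCayley_connected hA).exists_walk_length_eq_dist g h
  let f : SimpleGraph.mulCayley A →g SimpleGraph.mulCayley A :=
    ⟨fun x => k * x, fun hxy => SimpleGraph.mulCayley_adj_mul_iff_right.2 hxy⟩
  have := SimpleGraph.dist_le (w.map f)
  rwa [SimpleGraph.Walk.length_map, hw] at this

theorem dist_mul_left (hA : Subgroup.closure A = ⊤) (k g h : G) :
    (SimpleGraph.mulCayley A).dist (k * g) (k * h) = (SimpleGraph.mulCayley A).dist g h := by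
  refine le_antisymm (dist_mul_left_le hA k g h) ?_
  have := dist_mul_left_le hA k⁻¹ (k * g) (k * h)
  rwa [inv_mul_cancel_left, inv_mul_cancel_left] at this

theorem dist_eq_dist_one (hA : Subgroup.closure A = ⊤) (g h : G) :
    (SimpleGraph.mulCayley A).dist g h = (SimpleGraph.mulCayley A).dist 1 (g⁻¹ * h) := by
  rw [← dist_mul_left hA g⁻¹ g h, inv_mul_cancel]

theorem wordDist_eq_one (hA : Subgroup.closure A = ⊤) (g h : G) :
    wordDist A g h = wordDist A 1 (g⁻¹ * h) := by
  unfold wordDist; rw [dist_eq_dist_one hA]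

theorem wordDist_nonneg (g h : G) : 0 ≤ wordDist A g h := Nat.cast_nonneg _

theorem wordDist_comm (g h : G) : wordDist A g h = wordDist A h g := by
  unfold wordDist; rw [SimpleGraph.dist_comm]

theorem wordDist_triangle (hA : Subgroup.closure A = ⊤) (g h k : G) :
    wordDist A g k ≤ wordDist A g h + wordDist A h k := by
  have := (mulCayley_connected hA).dist_triangle (u := g) (v := h) (w := k)
  unfold wordDist; exact_mod_cast this

theorem wordDist_one_mul (hA : Subgroup.closure A = ⊤) (g s : G) :
    wordDist A g (g * s) = wordDist A 1 s := by
  rw [wordDist_eq_one hA, inv_mul_cancel_left]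

theorem exists_dist_one_le {S : Set G} (hS : S.Finite) :
    ∃ M : ℕ, ∀ x ∈ S, (SimpleGraph.mulCayley A).dist 1 x ≤ M := by
  obtain ⟨M, hM⟩ := (hS.image fun x => (SimpleGraph.mulCayley A).dist 1 x).bddAbove
  exact ⟨M, fun x hx => hM ⟨x, hx, rfl⟩⟩

/-- Balls of the word metric of a finite generating set are finite. -/
theorem finite_dist_one_le (hA : Subgroup.closure A = ⊤) (hfin : A.Finite) (n : ℕ) :
    {x : G | (SimpleGraph.mulCayley A).dist 1 x ≤ n}.Finite := by
  have hΓ := mulCayley_connected hA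
  induction n with
  | zero =>
    refine (Set.finite_singleton (1 : G)).subset fun x hx => ?_
    exact (hΓ.dist_eq_zero_iff.1 (Nat.le_zero.1 hx)).symm
  | succ n ih =>
    refine (ih.union (ih.image2 (fun x y => x * y) (hfin.union (hfin.image fun a => a⁻¹)))).subset
      fun x hx => ?_
    rcases Nat.lt_or_ge ((SimpleGraph.mulCayley A).dist 1 x) (n + 1) with h | h
    · exact Or.inl (Nat.lt_succ_iff.1 h)
    · right
      have hx' : (SimpleGraph.mulCayley A).dist 1 x = n + 1 := le_antisymm hx h
      obtain ⟨f, f0, f1, hf⟩ := exists_isDiscreteGeodesic hΓ 1 x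
      rw [hx'] at hf f1
      have h1 := hf 0 n (Nat.zero_le n) (Nat.le_succ n)
      rw [f0] at h1
      have h2 := (SimpleGraph.mulCayley_adj _ _ _).1 (hf.adj (Nat.lt_succ_self n))
      rw [f1] at h2
      refine ⟨f n, ?_, (f n)⁻¹ * x, ?_, by simp⟩
      · simp only [Set.mem_ofPred_eq]; omega
      · rcases h2.2 with h3 | h3
        · exact Or.inl h3
        · exact Or.inr ⟨_, h3, by simp⟩

/-- Endomorphisms are Lipschitz for the word metric. -/
theorem exists_dist_map_le (hA : Subgroup.closure A = ⊤) (hfin : A.Finite) (φ : G →* G) :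
    ∃ L : ℕ, ∀ g h, (SimpleGraph.mulCayley A).dist (φ g) (φ h) ≤
      L * (SimpleGraph.mulCayley A).dist g h := by
  have hΓ := mulCayley_connected hA
  obtain ⟨L, hL⟩ := exists_dist_one_le (A := A) (hfin.image φ)
  have hadj : ∀ u v, (SimpleGraph.mulCayley A).Adj u v →
      (SimpleGraph.mulCayley A).dist (φ u) (φ v) ≤ L := by
    intro u v huv
    rcases ((SimpleGraph.mulCayley_adj _ _ _).1 huv).2 with h | h
    · rw [dist_eq_dist_one hA, ← map_inv, ← map_mul]
      exact hL _ ⟨_, h, rfl⟩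
    · rw [SimpleGraph.dist_comm, dist_eq_dist_one hA, ← map_inv, ← map_mul]
      exact hL _ ⟨_, h, rfl⟩
  refine ⟨L, fun g h => ?_⟩
  obtain ⟨w, hw⟩ := hΓ.exists_walk_length_eq_dist g h
  rw [← hw]
  clear hw
  induction w with
  | nil => simp
  | cons h w ih =>
    have := hΓ.dist_triangle.trans (Nat.add_le_add (hadj _ _ h) ih)
    rw [SimpleGraph.Walk.length_cons]
    linarith

theorem gromovProduct_le_add_left (hA : Subgroup.closure A = ⊤) (p g g' h : G) :
    gromovProduct A p g h ≤ gromovProduct A p g' h + wordDist A g g' := by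
  have h1 := wordDist_triangle hA p g' g
  have h2 := wordDist_triangle hA g' g h
  rw [wordDist_comm g' g] at h1 h2
  unfold gromovProduct
  linarith

theorem gromovProduct_le_add_base (hA : Subgroup.closure A = ⊤) (p q g h : G) :
    gromovProduct A q g h ≤ gromovProduct A p g h + wordDist A p q := by
  have h1 := wordDist_triangle hA q p g
  have h2 := wordDist_triangle hA q p h
  rw [wordDist_comm q p] at h1 h2
  unfold gromovProduct
  linarith

/-- Left invariance of the word metric reduces the lower bound to distances from `1`; the upper
bound holds because endomorphisms are Lipschitz. -/
theorem isQuasiIsometricEmbedding_of_le (hA : Subgroup.closure A = ⊤) (hfin : A.Finite)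
    {φ : G →* G} {P C : ℝ} (h : ∀ x, wordDist A 1 x ≤ P * wordDist A 1 (φ x) + C) :
    IsQuasiIsometricEmbedding (wordDist A) (wordDist A) φ := by
  obtain ⟨L, hL⟩ := exists_dist_map_le hA hfin φ
  have hL' : ∀ g h, wordDist A (φ g) (φ h) ≤ L * wordDist A g h := fun g h => by
    unfold wordDist; exact_mod_cast hL g h
  have h1 : 1 ≤ max (max 1 P) L := (le_max_left _ _).trans (le_max_left _ _)
  have hP : P ≤ max (max 1 P) L := (le_max_right _ _).trans (le_max_left _ _)
  have hLL : (L : ℝ) ≤ max (max 1 P) L := le_max_right _ _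
  generalize max (max 1 P) (L : ℝ) = N at *
  refine ⟨N, max C 0, h1, le_max_right _ _, fun g k => ⟨?_, ?_⟩⟩
  · have h2 := h (g⁻¹ * k)
    rw [map_mul, map_inv, ← wordDist_eq_one hA, ← wordDist_eq_one hA] at h2
    have h3 := mul_le_mul_of_nonneg_right hP (wordDist_nonneg (A := A) (φ g) (φ k))
    have h4 : C ≤ N * max C 0 :=
      (le_max_left C 0).trans (le_mul_of_one_le_left (le_max_right _ _) h1)
    rw [sub_le_iff_le_add, one_div, inv_mul_le_iff₀ (by linarith)]
    linarith
  · have h2 := mul_le_mul_of_nonneg_right hLL (wordDist_nonneg (A := A) g k)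
    linarith [hL' g k, le_max_right C 0]

/-- Only the diagonal `g = h` matters, where Gromov products are distances from `p`; the change of
base point to `1` goes into the constant. -/
theorem isQuasiIsometricEmbedding_of_gromovProduct_le (hA : Subgroup.closure A = ⊤)
    (hfin : A.Finite) {φ : G →* G} {p : G} {P Q : ℝ} (hP : 0 < P)
    (h : ∀ g h, gromovProduct A p g h ≤ P * gromovProduct A p (φ g) (φ h) + Q) :
    IsQuasiIsometricEmbedding (wordDist A) (wordDist A) φ := by
  refine isQuasiIsometricEmbedding_of_le hA hfin (P := P)
    (C := wordDist A 1 p + P * wordDist A p 1 + Q) fun x => ?_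
  have h1 := h x x
  rw [gromovProduct_self, gromovProduct_self] at h1
  have h2 := wordDist_triangle hA 1 p x
  have h3 := mul_le_mul_of_nonneg_left (wordDist_triangle hA p 1 (φ x)) hP.le
  linarith

theorem IsQuasiIsometricEmbedding.exists_le {φ : G →* G}
    (h : IsQuasiIsometricEmbedding (wordDist A) (wordDist A) φ) :
    ∃ a b : ℕ, ∀ g h, (SimpleGraph.mulCayley A).dist g h ≤
      a * (SimpleGraph.mulCayley A).dist (φ g) (φ h) + b := by
  obtain ⟨L, K, hL, hK, h⟩ := h
  refine ⟨⌈L⌉₊, ⌈L * K⌉₊, fun g k => ?_⟩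
  have h1 := (h g k).1
  rw [sub_le_iff_le_add, one_div, inv_mul_le_iff₀ (by linarith)] at h1
  have h2 := mul_le_mul_of_nonneg_right (Nat.le_ceil L) (wordDist_nonneg (A := A) (φ g) (φ k))
  have h3 := Nat.le_ceil (L * K)
  have : wordDist A g k ≤ ⌈L⌉₊ * wordDist A (φ g) (φ k) + ⌈L * K⌉₊ := by linarith
  unfold wordDist at this
  exact_mod_cast this

/-- For a quasi-isometric endomorphism, shortest paths between image points are close to the
images of shortest paths. -/
theorem exists_close_to_map (hA : Subgroup.closure A = ⊤) (hfin : A.Finite) {D : ℕ}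
    (hD : HasThinTriangles (SimpleGraph.mulCayley A) D) {φ : G →* G}
    (h : IsQuasiIsometricEmbedding (wordDist A) (wordDist A) φ) :
    ∃ R : ℕ, ∀ g h w, (SimpleGraph.mulCayley A).dist (φ g) w +
      (SimpleGraph.mulCayley A).dist w (φ h) = (SimpleGraph.mulCayley A).dist (φ g) (φ h) →
      ∃ x, (SimpleGraph.mulCayley A).dist g x + (SimpleGraph.mulCayley A).dist x h =
        (SimpleGraph.mulCayley A).dist g h ∧ (SimpleGraph.mulCayley A).dist w (φ x) ≤ R := by
  have hΓ := mulCayley_connected hA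
  obtain ⟨L, hL⟩ := exists_dist_map_le hA hfin φ
  obtain ⟨a, b, hab⟩ := h.exists_le
  obtain ⟨R, hR⟩ := hD.exists_close_to_quasiGeodesic hΓ L a b
  refine ⟨R, fun g h w hw => ?_⟩
  obtain ⟨f, f0, f1, hf⟩ := exists_isDiscreteGeodesic hΓ g h
  have hstep : ∀ i < (SimpleGraph.mulCayley A).dist g h,
      (SimpleGraph.mulCayley A).dist (φ (f i)) (φ (f (i + 1))) ≤ L := fun i hi => by
    have := hL (f i) (f (i + 1))
    rwa [SimpleGraph.dist_eq_one_iff_adj.2 (hf.adj hi), mul_one] at this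
  have hquasi : ∀ i j, i ≤ j → j ≤ (SimpleGraph.mulCayley A).dist g h →
      j - i ≤ a * (SimpleGraph.mulCayley A).dist (φ (f i)) (φ (f j)) + b := fun i j hij hj => by
    have := hab (f i) (f j)
    rwa [hf i j hij hj] at this
  obtain ⟨i, hi, hi'⟩ := hR _ (fun i => φ (f i)) hstep hquasi w (by simpa only [f0, f1] using hw)
  have := hf.dist_add_dist hi
  rw [f0, f1] at this
  exact ⟨f i, this, hi'⟩

/-- A shortest path from `φ g` to `φ h` has a point `w` whose distance to `φ p` is controlled by the
Gromov product. By stability `w` is close to some `φ x` with `x` on a shortest path from `g` to `h`,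
and every such `x` is at distance at least `(g|h)_p` from `p`. -/
theorem gromovProduct_le_of_isQuasiIsometricEmbedding (hA : Subgroup.closure A = ⊤)
    (hfin : A.Finite) {D : ℕ} (hD : HasThinTriangles (SimpleGraph.mulCayley A) D) {φ : G →* G}
    (h : IsQuasiIsometricEmbedding (wordDist A) (wordDist A) φ) (p : G) :
    ∃ P Q : ℝ, 0 < P ∧
      ∀ g h, gromovProduct A p g h ≤ P * gromovProduct A p (φ g) (φ h) + Q := by
  have hΓ := mulCayley_connected hA
  obtain ⟨R, hR⟩ := exists_close_to_map hA hfin hD h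
  obtain ⟨a, b, hab⟩ := h.exists_le
  -- The factor is `a + 1` because `a` may be zero.
  refine ⟨a + 1, (a + 1) * (wordDist A p (φ p) + 2 * D + 1 + R) + b, by positivity,
    fun g h => ?_⟩
  obtain ⟨w, hw, hw'⟩ := hD.exists_dist_le_gromov hΓ (φ p) (φ g) (φ h)
  obtain ⟨x, hx, hx'⟩ := hR g h w hw
  have h1 : gromovProduct A p g h ≤ wordDist A p x := by
    have e : wordDist A g x + wordDist A x h = wordDist A g h := by
      unfold wordDist; exact_mod_cast hx
    have t1 := wordDist_triangle hA p x g
    have t2 := wordDist_triangle hA p x h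
    rw [wordDist_comm x g] at t1
    unfold gromovProduct
    linarith
  have h2 : wordDist A p x ≤ a * wordDist A (φ p) (φ x) + b := by
    unfold wordDist; exact_mod_cast hab p x
  have h3 : wordDist A (φ p) w ≤ gromovProduct A (φ p) (φ g) (φ h) + 2 * D + 1 := by
    have : 2 * wordDist A (φ p) w + wordDist A (φ g) (φ h) ≤
        wordDist A (φ p) (φ g) + wordDist A (φ p) (φ h) + (4 * D + 2) := by
      unfold wordDist; exact_mod_cast hw'
    unfold gromovProduct
    linarith
  have h4 := wordDist_triangle hA (φ p) w (φ x)
  have h5 : wordDist A w (φ x) ≤ R := by unfold wordDist; exact_mod_cast hx'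
  have h6 := gromovProduct_le_add_base hA p (φ p) (φ g) (φ h)
  have h7 : wordDist A (φ p) (φ x) ≤
      gromovProduct A p (φ g) (φ h) + (wordDist A p (φ p) + 2 * D + 1 + R) := by linarith
  have h8 := mul_le_mul_of_nonneg_left h7 (by positivity : (0 : ℝ) ≤ a + 1)
  linarith [wordDist_nonneg (A := A) (φ p) (φ x)]

theorem IsQuasiIsometricEmbedding.finite_ker (hA : Subgroup.closure A = ⊤) (hfin : A.Finite)
    {φ : G →* G} (h : IsQuasiIsometricEmbedding (wordDist A) (wordDist A) φ) :
    (φ.ker : Set G).Finite := by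
  obtain ⟨a, b, hab⟩ := h.exists_le
  refine (finite_dist_one_le hA hfin b).subset fun x hx => ?_
  have h1 := hab 1 x
  rw [map_one, (MonoidHom.mem_ker).1 hx, SimpleGraph.dist_self, mul_zero, zero_add] at h1
  exact h1

/-- An arbitrary geodesic `ξ` of the realization need not come from a chosen vertex path. A vertex
`v` of the edge of `ξ t` is however almost between `φ g` and `φ k`: their Gromov product based at
`v` is at most `1`. So `v` is close to a shortest path, and hence to the image. -/
theorem IsQuasiIsometricEmbedding.isQuasiconvex_range (hA : Subgroup.closure A = ⊤)
    (hfin : A.Finite) {D : ℕ} (hD : HasThinTriangles (SimpleGraph.mulCayley A) D) {φ : G →* G}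
    (h : IsQuasiIsometricEmbedding (wordDist A) (wordDist A) φ) : IsQuasiconvex A φ.range := by
  have hΓ := mulCayley_connected hA
  obtain ⟨R, hR⟩ := exists_close_to_map hA hfin hD h
  -- At most `1` from `ξ t` to `v`, `2 * D + 2` from `v` to the shortest path, and `R` from there to
  -- the image.
  refine ⟨2 * D + 3 + R, by positivity, ?_⟩
  rintro _ ⟨g, rfl⟩ _ ⟨k, rfl⟩ ξ s ⟨hs, ξ0, ξ1, hξ⟩ _ ⟨t, ht, rfl⟩
  obtain ⟨v, hv⟩ := (ξ t).support_nonempty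
  have hc := (ξ t).coord_nonneg v
  have h1 := Realization.dist_le_rdist_add_one hΓ (φ g) (ξ t) hv
  have h2 := Realization.dist_le_rdist_add_one hΓ (φ k) (ξ t) hv
  rw [← ξ0, hξ 0 ⟨le_rfl, hs⟩ t ht, zero_sub, abs_neg, abs_of_nonneg ht.1] at h1
  rw [← ξ1, hξ s ⟨hs, le_rfl⟩ t ht, abs_of_nonneg (by linarith [ht.2])] at h2
  have h3 := Realization.rdist_vertex_le hΓ (Realization.vertex (SimpleGraph.mulCayley A) (φ g))
    (φ k) (Realization.mem_support_vertex (φ g))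
  have h4 : (Realization.vertex (SimpleGraph.mulCayley A) (φ g)).coord (φ g) = 1 := by
    simp [Realization.vertex]
  rw [h4, ← ξ0, ← ξ1, hξ 0 ⟨le_rfl, hs⟩ s ⟨hs, le_rfl⟩, zero_sub, abs_neg, abs_of_nonneg hs] at h3
  have h5 : (SimpleGraph.mulCayley A).dist (φ g) v + (SimpleGraph.mulCayley A).dist (φ k) v ≤
      (SimpleGraph.mulCayley A).dist (φ g) (φ k) + 2 := by
    have : ((SimpleGraph.mulCayley A).dist (φ g) v : ℝ) + (SimpleGraph.mulCayley A).dist (φ k) v ≤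
      (SimpleGraph.mulCayley A).dist (φ g) (φ k) + 2 := by linarith
    exact_mod_cast this
  obtain ⟨w, hw, hw'⟩ := hD.exists_dist_le_gromov hΓ v (φ g) (φ k)
  obtain ⟨x, -, hx⟩ := hR g k w hw
  have h6 := hΓ.dist_triangle (u := v) (v := w) (w := φ x)
  rw [SimpleGraph.dist_comm (u := v) (v := φ g), SimpleGraph.dist_comm (u := v) (v := φ k)] at hw'
  have h7 : (SimpleGraph.mulCayley A).dist v (φ x) ≤ 2 * D + 2 + R := by omega
  have h8 : ((SimpleGraph.mulCayley A).dist v (φ x) : ℝ) ≤ 2 * D + 2 + R := by exact_mod_cast h7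
  have h9 := Realization.rdist_vertex_le hΓ (ξ t) (φ x) hv
  refine le_trans (ciInf_le ⟨0, ?_⟩
    (⟨_, ⟨φ x, ⟨x, rfl⟩, rfl⟩⟩ : Realization.vertex _ '' (φ.range : Set G))) (by linarith)
  rintro _ ⟨z, rfl⟩
  exact Realization.rdist_nonneg _ _

theorem finite_preimage_of_finite_ker {φ : G →* G} (h : (φ.ker : Set G).Finite) {S : Set G}
    (hS : S.Finite) : (φ ⁻¹' S).Finite := by
  refine hS.preimage' fun b _ => ?_
  by_cases hb : ∃ g, φ g = b
  · obtain ⟨g, rfl⟩ := hb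
    refine (h.image fun k => g * k).subset fun x hx => ⟨g⁻¹ * x, ?_, by simp⟩
    have hx : φ x = φ g := hx
    simp [MonoidHom.mem_ker, hx]
  · convert Set.finite_empty
    ext x
    simp only [Set.mem_preimage, Set.mem_singleton_iff, Set.mem_empty_iff_false, iff_false]
    exact fun hx => hb ⟨x, hx⟩

/-- This is the argument of the Milnor–Švarc lemma: quasiconvexity provides the `y i` with `φ (y i)`
near the `i`-th vertex of a shortest path from `1` to `φ x`, and finiteness of the kernel bounds the
steps from `y i` to `y (i + 1)`. Hyperbolicity plays no role. -/
theorem IsQuasiconvex.isQuasiIsometricEmbedding (hA : Subgroup.closure A = ⊤) (hfin : A.Finite)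
    {φ : G →* G} (hker : (φ.ker : Set G).Finite) (h : IsQuasiconvex A φ.range) :
    IsQuasiIsometricEmbedding (wordDist A) (wordDist A) φ := by
  have hΓ := mulCayley_connected hA
  obtain ⟨q, hq, h⟩ := h
  -- Consecutive points `φ (y i)` are at most `2 * ⌈q + 1⌉₊ + 1` apart: one edge of the path and two
  -- excursions to the image.
  obtain ⟨M, hM⟩ := exists_dist_one_le (A := A)
    (finite_preimage_of_finite_ker hker (finite_dist_one_le hA hfin (2 * ⌈q + 1⌉₊ + 1)))
  -- Each step of the path costs `M`; the term `2 * M` pays for the passages from `1` to `y 0` and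
  -- from the last `y i` to `x`.
  refine isQuasiIsometricEmbedding_of_le hA hfin (P := M) (C := 2 * M) fun x => ?_
  obtain ⟨f, f0, f1, hf⟩ := exists_isDiscreteGeodesic hΓ 1 (φ x)
  obtain ⟨ξ, hξ, hi, -⟩ := hf.exists_isGeodesic hΓ
  rw [f0, f1] at hξ
  have near : ∀ i, ∃ y, i ≤ (SimpleGraph.mulCayley A).dist 1 (φ x) →
      (SimpleGraph.mulCayley A).dist (f i) (φ y) ≤ ⌈q + 1⌉₊ := by
    intro i
    by_cases hin : i ≤ (SimpleGraph.mulCayley A).dist 1 (φ x)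
    · have h1 := h 1 (one_mem _) (φ x) ⟨x, rfl⟩ ξ _ hξ (ξ i)
        ⟨i, ⟨Nat.cast_nonneg _, by exact_mod_cast hin⟩, rfl⟩
      rw [hi i hin] at h1
      unfold distToSet at h1
      have hne : Nonempty ↑(Realization.vertex (SimpleGraph.mulCayley A) '' (φ.range : Set G)) :=
        ⟨⟨_, 1, one_mem _, rfl⟩⟩
      obtain ⟨⟨_, _, ⟨y, rfl⟩, rfl⟩, hy⟩ := exists_lt_of_ciInf_lt (h1.trans_lt (lt_add_one q))
      refine ⟨y, fun _ => ?_⟩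
      have h2 := Realization.dist_le_rdist_add_one hΓ (f i)
        (Realization.vertex (SimpleGraph.mulCayley A) (φ y)) (Realization.mem_support_vertex (φ y))
      have h3 : (Realization.vertex (SimpleGraph.mulCayley A) (φ y)).coord (φ y) = 1 := by
        simp [Realization.vertex]
      dsimp only at hy
      have : ((SimpleGraph.mulCayley A).dist (f i) (φ y) : ℝ) ≤ ⌈q + 1⌉₊ := by
        linarith [Nat.le_ceil (q + 1)]
      exact_mod_cast this
    · exact ⟨1, fun h' => absurd h' hin⟩
  choose y hy using near
  have hM' : ∀ u v, (SimpleGraph.mulCayley A).dist (φ u) (φ v) ≤ 2 * ⌈q + 1⌉₊ + 1 →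
      (SimpleGraph.mulCayley A).dist u v ≤ M := by
    intro u v huv
    rw [dist_eq_dist_one hA]
    refine hM _ ?_
    rw [Set.mem_preimage, Set.mem_ofPred_eq, map_mul, map_inv, ← dist_eq_dist_one hA]
    exact huv
  have chain : ∀ i ≤ (SimpleGraph.mulCayley A).dist 1 (φ x),
      (SimpleGraph.mulCayley A).dist 1 (y i) ≤ M * i + M := by
    intro i
    induction i with
    | zero =>
      intro h0
      have h1 := hy 0 h0
      rw [f0, ← map_one φ] at h1
      have := hM' 1 (y 0) (by omega)
      omega
    | succ i ih =>
      intro hin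
      have h1 := hy i (by omega)
      have h2 := hy (i + 1) hin
      have h3 := SimpleGraph.dist_eq_one_iff_adj.2 (hf.adj hin)
      have h4 := hΓ.dist_triangle (u := φ (y i)) (v := f i) (w := φ (y (i + 1)))
      have h5 := hΓ.dist_triangle (u := f i) (v := f (i + 1)) (w := φ (y (i + 1)))
      rw [SimpleGraph.dist_comm] at h1
      have h6 := hM' (y i) (y (i + 1)) (by omega)
      have h7 := hΓ.dist_triangle (u := 1) (v := y i) (w := y (i + 1))
      have h8 := ih (by omega)
      rw [mul_add, mul_one]
      omega
  have h1 := hy _ le_rfl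
  rw [f1, SimpleGraph.dist_comm] at h1
  have h2 := hM' _ x (h1.trans (by omega))
  have h3 := chain _ le_rfl
  have h4 := hΓ.dist_triangle (u := 1) (v := y ((SimpleGraph.mulCayley A).dist 1 (φ x))) (w := x)
  have h5 : (SimpleGraph.mulCayley A).dist 1 x ≤
      M * (SimpleGraph.mulCayley A).dist 1 (φ x) + 2 * M := by omega
  unfold wordDist
  exact_mod_cast h5

end WordMetric

/-! ### Hölder conditions for visual metrics -/

section Visual

theorem satisfiesHolder_of_dist_le {X Y : Type*} [PseudoMetricSpace X] [PseudoMetricSpace Y]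
    {f : X → Y} {C r : ℝ} (hC : 0 ≤ C) (hr : 0 < r)
    (h : ∀ x y, dist (f x) (f y) ≤ C * dist x y ^ r) : SatisfiesHolder f := by
  lift C to ℝ≥0 using hC
  lift r to ℝ≥0 using hr.le
  refine ⟨C, r, by exact_mod_cast hr, fun x y => ?_⟩
  rw [edist_nndist, edist_nndist, ← ENNReal.coe_rpow_of_nonneg _ r.coe_nonneg, ← ENNReal.coe_mul,
    ENNReal.coe_le_coe, ← NNReal.coe_le_coe]
  push_cast
  exact h x y

variable {G : Type*} [Group G] [MetricSpace G] {A : Set G} {p : G} {γ T : ℝ}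

theorem IsVisual.satisfiesHolder_of_gromovProduct_le (hd : IsVisual A p γ T) (hγ : 0 < γ)
    (hT : 1 ≤ T) {φ : G → G} {P Q : ℝ} (hP : 0 < P)
    (h : ∀ g h, gromovProduct A p g h ≤ P * gromovProduct A p (φ g) (φ h) + Q) :
    SatisfiesHolder φ := by
  have hT0 : 0 < T := by linarith
  -- Exponentiating the hypothesis gives `exp (-γ (φ g|φ k)) ≤ exp (γ Q / P) * exp (-γ (g|k)) ^ (1 /
  -- P)`, and `exp (-γ (g|k)) ≤ T * dist g k`.
  refine satisfiesHolder_of_dist_le (C := T * Real.exp (γ * Q / P) * T ^ (1 / P)) (r := 1 / P)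
    (by positivity) (by positivity) fun g k => ?_
  by_cases e : φ g = φ k
  · rw [e, dist_self]; positivity
  have e' : g ≠ k := fun h => e (by rw [h])
  have h1 := hd.exp_le hT e'
  refine (hd _ _ e).2.trans ?_
  rw [mul_assoc, mul_assoc, ← Real.mul_rpow hT0.le dist_nonneg]
  refine mul_le_mul_of_nonneg_left ?_ hT0.le
  have h2 := Real.rpow_le_rpow (Real.exp_pos _).le h1 (by positivity : 0 ≤ 1 / P)
  refine le_trans ?_ (mul_le_mul_of_nonneg_left h2 (Real.exp_pos _).le)
  rw [← Real.exp_mul, ← Real.exp_add, Real.exp_le_exp]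
  have h3 : gromovProduct A p g k / P ≤ gromovProduct A p (φ g) (φ k) + Q / P := by
    rw [div_le_iff₀ hP, add_mul, div_mul_cancel₀ _ hP.ne']
    linarith [h g k]
  have h4 := mul_le_mul_of_nonneg_left h3 hγ.le
  have e1 : γ * Q / P = γ * (Q / P) := by ring
  have e2 : -γ * gromovProduct A p g k * (1 / P) = -(γ * (gromovProduct A p g k / P)) := by ring
  rw [e1, e2]
  linarith

theorem IsVisual.gromovProduct_le_of_satisfiesHolder (hA : Subgroup.closure A = ⊤)
    (hd : IsVisual A p γ T) (hγ : 0 < γ) (hT : 1 ≤ T) {φ : G →* G} (hφ : φ ≠ 1)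
    (h : SatisfiesHolder φ) :
    ∃ P Q : ℝ, 0 < P ∧
      ∀ g h, gromovProduct A p g h ≤ P * gromovProduct A p (φ g) (φ h) + Q := by
  obtain ⟨C, r, hr, h⟩ := h
  have hr : (0 : ℝ) < r := hr
  have hT0 : 0 < T := by linarith
  -- `C + 1` replaces `C` so that the logarithm is taken of a positive number.
  have hC0 : (0 : ℝ) < C + 1 := by positivity
  -- points with different images
  have key : ∃ K : ℝ, 0 ≤ K ∧ ∀ g k, φ g ≠ φ k →
      gromovProduct A p g k ≤ 1 / r * gromovProduct A p (φ g) (φ k) + K := by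
    refine ⟨|Real.log (T * ((C + 1) * T ^ (r : ℝ)))| / (γ * r), by positivity, fun g k e => ?_⟩
    have e' : g ≠ k := fun h => e (by rw [h])
    have h1 := hd.exp_le hT e
    have h2 := h.dist_le g k
    have h3 := Real.rpow_le_rpow dist_nonneg (hd _ _ e').2 hr.le
    rw [Real.mul_rpow hT0.le (Real.exp_pos _).le, ← Real.exp_mul] at h3
    have h4 : dist (φ g) (φ k) ≤
        (C + 1) * (T ^ (r : ℝ) * Real.exp (-γ * gromovProduct A p g k * r)) := by
      refine h2.trans (mul_le_mul (by linarith) h3 (by positivity) hC0.le)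
    have h5 := h1.trans (mul_le_mul_of_nonneg_left h4 hT0.le)
    have h6 := Real.log_le_log (Real.exp_pos _) h5
    rw [Real.log_exp, ← mul_assoc (C + 1 : ℝ), ← mul_assoc T,
      Real.log_mul (by positivity) (Real.exp_pos _).ne', Real.log_exp] at h6
    have h7 := le_abs_self (Real.log (T * ((C + 1) * T ^ (r : ℝ))))
    have h8 : 1 / r * gromovProduct A p (φ g) (φ k) +
        |Real.log (T * ((C + 1) * T ^ (r : ℝ)))| / (γ * r) =
        (γ * gromovProduct A p (φ g) (φ k) + |Real.log (T * ((C + 1) * T ^ (r : ℝ)))|) /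
          (γ * r) := by
      field_simp
    rw [h8, le_div_iff₀ (by positivity)]
    linarith
  obtain ⟨K, hK, key⟩ := key
  obtain ⟨s, hs⟩ : ∃ s, φ s ≠ 1 := by
    by_contra hn
    push Not at hn
    exact hφ (MonoidHom.ext hn)
  have hr' : (0 : ℝ) < 1 / r := by positivity
  have hQ1 := wordDist_nonneg (A := A) 1 s
  have hQ2 := mul_nonneg hr'.le (wordDist_nonneg (A := A) 1 (φ s))
  refine ⟨1 / r, K + wordDist A 1 s + 1 / r * wordDist A 1 (φ s), hr', fun g k => ?_⟩
  -- If the images agree, `g * s` and `k` have different images. The shift changes the Gromov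
  -- products by at most the lengths of `s` and `φ s`, which are absorbed in the constant.
  by_cases e : φ g = φ k
  · have h1 := key (g * s) k (by rw [map_mul, ← e]; simpa using hs)
    have h2 := gromovProduct_le_add_left hA p g (g * s) k
    have h3 := gromovProduct_le_add_left hA p (φ (g * s)) (φ g) (φ k)
    rw [wordDist_one_mul hA] at h2
    rw [wordDist_comm, map_mul, wordDist_one_mul hA, ← map_mul] at h3
    have h4 := mul_le_mul_of_nonneg_left h3 hr'.le
    linarith
  · linarith [key g k e]

/-- The Hölder inequality is a closed condition on pairs, and it holds on the dense subset of pairs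
from `X`. -/
theorem HolderWith.completion_map {X Y : Type*} [MetricSpace X] [MetricSpace Y] {f : X → Y}
    {C r : ℝ≥0} (h : HolderWith C r f) (hr : 0 < r) :
    HolderWith C r (UniformSpace.Completion.map f) := by
  intro x y
  have hf := h.uniformContinuous hr
  have hm : Continuous (UniformSpace.Completion.map f) := UniformSpace.Completion.continuous_map
  induction x, y using UniformSpace.Completion.induction_on₂ with
  | hp =>
    refine isClosed_le ?_ ?_
    · exact (hm.comp continuous_fst).edist (hm.comp continuous_snd)
    · refine ENNReal.continuous_const_mul ENNReal.coe_ne_top |>.comp ?_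
      exact (ENNReal.continuous_rpow_const).comp continuous_edist
  | ih a b =>
    rw [UniformSpace.Completion.map_coe hf, UniformSpace.Completion.map_coe hf,
      UniformSpace.Completion.edist_eq, UniformSpace.Completion.edist_eq]
    exact h a b

/-- The metric of `Ĝ` is induced by the bijection `toCompletion`, so the extension of `φ` to the
completion can be transported to `Ĝ` with the same constants. Conversely, `G` sits isometrically in
`Ĝ`, so the condition restricts. -/
theorem IsVisual.satisfiesHolder_iff_exists_extension (hA : Subgroup.closure A = ⊤)
    (hd : IsVisual A p γ T) (hγ : 0 < γ) (hT : 1 ≤ T) (φ : G → G) :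
    SatisfiesHolder φ ↔ ∃ Φ : Hat A p → Hat A p,
      (∀ g : G, Φ (Hat.ofGroup g) = Hat.ofGroup (φ g)) ∧ SatisfiesHolder Φ := by
  constructor
  · rintro ⟨C, r, hr, h⟩
    let e := Equiv.ofBijective _ (toCompletion_bijective hA hd hγ hT)
    have he : ∀ x, toCompletion A p (e.symm x) = x := e.apply_symm_apply
    refine ⟨fun x => e.symm (UniformSpace.Completion.map φ (toCompletion A p x)), fun g => ?_,
      C, r, hr, fun x y => ?_⟩
    · rw [Equiv.symm_apply_eq]
      exact UniformSpace.Completion.map_coe (h.uniformContinuous hr) g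
    · show edist (toCompletion A p _) (toCompletion A p _) ≤ _
      rw [he, he]
      exact h.completion_map hr _ _
  · rintro ⟨Φ, hΦ, C, r, hr, h⟩
    refine ⟨C, r, hr, fun x y => ?_⟩
    have h1 := h (Hat.ofGroup x) (Hat.ofGroup y)
    rw [hΦ, hΦ] at h1
    have h2 : ∀ a b : G, edist (Hat.ofGroup a : Hat A p) (Hat.ofGroup b) = edist a b :=
      fun a b => UniformSpace.Completion.edist_eq a b
    rwa [h2, h2] at h1

end Visual

end HyperbolicGroup

theorem theorem4p3 {G : Type*} [Group G] (A : Set G) (hG : IsHyperbolicGroup A)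
    (φ : G →* G) (hφ : φ ≠ 1)
    [MetricSpace G] (p : G) (γ T : ℝ) (hγ : 0 < γ) (hT : 1 ≤ T) (hd : IsVisual A p γ T) :
    List.TFAE [
      SatisfiesHolder φ,
      ∃ Φ : Hat A p → Hat A p,
        (∀ g : G, Φ (Hat.ofGroup g) = Hat.ofGroup (φ g)) ∧ SatisfiesHolder Φ,
      ∃ P Q : ℝ, 0 < P ∧
        ∀ g h : G, gromovProduct A p g h ≤ P * gromovProduct A p (φ g) (φ h) + Q,
      IsQuasiIsometricEmbedding (wordDist A) (wordDist A) φ,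
      (φ.ker : Set G).Finite ∧ IsQuasiconvex A φ.range] := by
  obtain ⟨hfin, hA, δ, -, hδ⟩ := hG
  obtain ⟨D, hD⟩ := hδ.hasThinTriangles (mulCayley_connected hA)
  tfae_have 1 ↔ 2 := hd.satisfiesHolder_iff_exists_extension hA hγ hT φ
  tfae_have 1 → 3 := hd.gromovProduct_le_of_satisfiesHolder hA hγ hT hφ
  tfae_have 3 → 1 := fun ⟨_, _, hP, h⟩ => hd.satisfiesHolder_of_gromovProduct_le hγ hT hP h
  tfae_have 3 → 4 := fun ⟨_, _, hP, h⟩ =>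
    isQuasiIsometricEmbedding_of_gromovProduct_le hA hfin hP h
  tfae_have 4 → 3 := fun h => gromovProduct_le_of_isQuasiIsometricEmbedding hA hfin hD h p
  tfae_have 4 → 5 := fun h => ⟨h.finite_ker hA hfin, h.isQuasiconvex_range hA hfin hD⟩
  tfae_have 5 → 4 := fun h => h.2.isQuasiIsometricEmbedding hA hfin h.1
  tfae_finish
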